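/- Let $(\Omega,\mu)$ be a $\sigma$-finite measure space, let $\mathbb K\in\{\mathbb R,\mathbb C\}$, and let $L^0(\Omega)$ be the space of measurable functions $\Omega\to\mathbb K$, with functions identified when they agree a.e. A *Banach function space over $(\Omega,\mu)$* is a linear subspace $X\subseteq L^0(\Omega)$ with a complete norm $\|\cdot\|_X$ such that: (ideal property) if $f\in X$, $g\in L^0(\Omega)$ and $|g|\le|f|$ a.e., then $g\in X$ and $\|g\|_X\le\|f\|_X$; (saturation property) every measurable $E\subseteq\Omega$ with $\mu(E)>0$ has a measurable subset $F\subseteq E$ with $\mu(F)>0$ and $\mathbf 1_F\in X$. The *Köthe dual* of $X$ is the space $X'=\{g\in L^0(\Omega): fg\in L^1(\Omega)\text{ for all }f\in X\}$ with norm $\|g\|_{X'}=\sup_{\|f\|_X=1}\|fg\|_{L^1(\Omega)}$ (where $\sup\emptyset=0$). $X$ has the *Fatou property* if, whenever $f_n\in X$, $f\in L^0(\Omega)$, $0\le f_n\uparrow f$ a.e. and $\sup_n\|f_n\|_X<\infty$, one has $f\in X$ and $\|f\|_X=\sup_n\|f_n\|_X$. The space $X$ (respectively $X'$) is *order-continuous*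 if $f_n\downarrow 0$ pointwise a.e., with all $f_n$ in the space, implies that the norms of $f_n$ decrease to $0$. Finally, $X$ is *reflexive* if the canonical embedding $X\to X^{**}$ is surjective. **Corollary.** Let $X$ be a Banach function space over $(\Omega,\mu)$. Then $X$ is reflexive if and only if $X$ has the Fatou property and both $X$ and $X'$ are order-continuous. -/

import Mathlib

open MeasureTheory Filter Topology
open scoped ComplexOrder

noncomputable section

/-- A normed space `X ⊆ L⁰(Ω)` of (a.e. classes of) measurable scalar-valued functions: a linear
subspace together with a norm on it. -/
structure NormedFunctionSpace (𝕜 : Type*) [RCLike 𝕜] {Ω : Type*} [MeasurableSpace Ω]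
    (μ : Measure Ω) where
  /-- the underlying linear subspace of `L⁰(Ω)` -/
  carrier : Submodule 𝕜 (Ω →ₘ[μ] 𝕜)
  /-- the norm -/
  nrm : carrier → ℝ
  nrm_nonneg : ∀ f, 0 ≤ nrm f
  nrm_smul : ∀ (c : 𝕜) (f : carrier), nrm (c • f) = ‖c‖ * nrm f
  nrm_add_le : ∀ f g : carrier, nrm (f + g) ≤ nrm f + nrm g
  nrm_eq_zero_iff : ∀ f : carrier, nrm f = 0 ↔ f = 0

namespace NormedFunctionSpace

variable {𝕜 : Type*} [RCLike 𝕜] {Ω : Type*} [MeasurableSpace Ω] {μ : Measure Ω}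

instance (X : NormedFunctionSpace 𝕜 μ) : Norm X.carrier := ⟨X.nrm⟩

theorem core (X : NormedFunctionSpace 𝕜 μ) : NormedSpace.Core 𝕜 X.carrier where
  norm_nonneg := X.nrm_nonneg
  norm_smul := X.nrm_smul
  norm_triangle := X.nrm_add_le
  norm_eq_zero_iff := X.nrm_eq_zero_iff

instance (X : NormedFunctionSpace 𝕜 μ) : NormedAddCommGroup X.carrier :=
  NormedAddCommGroup.ofCore X.core

instance (X : NormedFunctionSpace 𝕜 μ) : NormedSpace 𝕜 X.carrier :=
  NormedSpace.ofCore X.core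

/-- `X` is complete with respect to its norm. -/
def IsComplete (X : NormedFunctionSpace 𝕜 μ) : Prop :=
  CompleteSpace X.carrier

/-- Ideal property: if `f ∈ X`, `g ∈ L⁰` and `|g| ≤ |f|` a.e., then `g ∈ X` and `‖g‖ ≤ ‖f‖`. -/
def HasIdealProperty (X : NormedFunctionSpace 𝕜 μ) : Prop :=
  ∀ (f : X.carrier) (g : Ω →ₘ[μ] 𝕜), (∀ᵐ x ∂μ, ‖g x‖ ≤ ‖(f : Ω →ₘ[μ] 𝕜) x‖) →
    ∃ hg : g ∈ X.carrier, ‖(⟨g, hg⟩ : X.carrier)‖ ≤ ‖f‖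

/-- Saturation property: every measurable set of positive measure contains a measurable set `F`
of positive measure whose indicator function is in `X`. -/
def HasSaturationProperty (X : NormedFunctionSpace 𝕜 μ) : Prop :=
  ∀ E : Set Ω, MeasurableSet E → 0 < μ E →
    ∃ F ⊆ E, MeasurableSet F ∧ 0 < μ F ∧
      ∃ f ∈ X.carrier, f =ᵐ[μ] F.indicator fun _ => (1 : 𝕜)

/-- `X` is reflexive: the canonical embedding `X → X**` is onto. -/
def IsReflexive (X : NormedFunctionSpace 𝕜 μ) : Prop :=
  Function.Surjective (NormedSpace.inclusionInDoubleDual 𝕜 X.carrier)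

/-- Fatou property: if `0 ≤ fₙ ↑ f` a.e. with `fₙ ∈ X` and `sup ‖fₙ‖ < ∞`, then `f ∈ X` and
`‖f‖ = sup ‖fₙ‖`. (For scalars, `z ≤ w` means that `w - z` is real and nonnegative.) -/
def HasFatouProperty (X : NormedFunctionSpace 𝕜 μ) : Prop :=
  ∀ (f : ℕ → X.carrier) (g : Ω →ₘ[μ] 𝕜),
    (∀ n, ∀ᵐ x ∂μ, 0 ≤ (f n : Ω →ₘ[μ] 𝕜) x) →
    (∀ᵐ x ∂μ, Monotone fun n => (f n : Ω →ₘ[μ] 𝕜) x) →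
    (∀ᵐ x ∂μ, Tendsto (fun n => (f n : Ω →ₘ[μ] 𝕜) x) atTop (𝓝 (g x))) →
    BddAbove (Set.range fun n => ‖f n‖) →
    ∃ hg : g ∈ X.carrier, IsLUB (Set.range fun n => ‖f n‖) ‖(⟨g, hg⟩ : X.carrier)‖

/-- Order-continuity: `fₙ ↓ 0` pointwise a.e. with `fₙ ∈ X` implies `‖fₙ‖ ↓ 0`. -/
def IsOrderContinuous (X : NormedFunctionSpace 𝕜 μ) : Prop :=
  ∀ f : ℕ → X.carrier,
    (∀ᵐ x ∂μ, Antitone fun n => (f n : Ω →ₘ[μ] 𝕜) x) →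
    (∀ᵐ x ∂μ, Tendsto (fun n => (f n : Ω →ₘ[μ] 𝕜) x) atTop (𝓝 0)) →
    Antitone (fun n => ‖f n‖) ∧ Tendsto (fun n => ‖f n‖) atTop (𝓝 0)

end NormedFunctionSpace

/-- A Banach function space over `(Ω, μ)`: a complete normed space `X ⊆ L⁰(Ω)` with the ideal
property and the saturation property. -/
structure BanachFunctionSpace (𝕜 : Type*) [RCLike 𝕜] {Ω : Type*} [MeasurableSpace Ω]
    (μ : Measure Ω) extends NormedFunctionSpace 𝕜 μ where
  isComplete : toNormedFunctionSpace.IsComplete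
  ideal : toNormedFunctionSpace.HasIdealProperty
  saturated : toNormedFunctionSpace.HasSaturationProperty

namespace BanachFunctionSpace

variable {𝕜 : Type*} [RCLike 𝕜] {Ω : Type*} [MeasurableSpace Ω] {μ : Measure Ω}

/-- The Köthe dual `X' = {g ∈ L⁰ : fg ∈ L¹ for all f ∈ X}` as a linear subspace of `L⁰`. -/
def kotheSubmodule (X : BanachFunctionSpace 𝕜 μ) : Submodule 𝕜 (Ω →ₘ[μ] 𝕜) where
  carrier := {g | ∀ f ∈ X.carrier, Integrable (fun x => f x * g x) μ}
  add_mem' {g h} hg hh f hf := by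
    refine ((hg f hf).add (hh f hf)).congr ?_
    filter_upwards [AEEqFun.coeFn_add g h] with x hx
    simp [hx, mul_add]
  zero_mem' f hf := by
    refine (integrable_zero Ω 𝕜 μ).congr ?_
    filter_upwards [AEEqFun.coeFn_zero (α := Ω) (μ := μ) (β := 𝕜)] with x hx
    simp [hx]
  smul_mem' c g hg f hf := by
    refine ((hg f hf).const_mul c).congr ?_
    filter_upwards [AEEqFun.coeFn_smul c g] with x hx
    simp [hx]
    ring

/-- The Köthe dual norm `‖g‖_{X'} = sup {‖fg‖_{L¹} : f ∈ X, ‖f‖_X = 1}`. -/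
def kotheNorm (X : BanachFunctionSpace 𝕜 μ) (g : X.kotheSubmodule) : ℝ :=
  sSup {r : ℝ | ∃ f : X.carrier, ‖f‖ = 1 ∧
    r = ∫ x, ‖(f : Ω →ₘ[μ] 𝕜) x * (g : Ω →ₘ[μ] 𝕜) x‖ ∂μ}

/-- Norm limits dominate: if `|q| ≤ |aₘ|` for all large `m` and `aₘ → h` in `X`,
then `|q| ≤ |h|`. -/
theorem norm_le_of_tendsto (X : BanachFunctionSpace 𝕜 μ) (a : ℕ → X.carrier) (h : X.carrier)
    (ha : Tendsto a atTop (𝓝 h)) (q : Ω →ₘ[μ] 𝕜)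
    (hq : ∀ᶠ m in atTop, ∀ᵐ x ∂μ, ‖q x‖ ≤ ‖(a m : Ω →ₘ[μ] 𝕜) x‖) :
    ∀ᵐ x ∂μ, ‖q x‖ ≤ ‖(h : Ω →ₘ[μ] 𝕜) x‖ := by
  have hmeas : AEStronglyMeasurable
      (fun x => ((max (‖q x‖ - ‖(h : Ω →ₘ[μ] 𝕜) x‖) 0 : ℝ) : 𝕜)) μ := by
    refine RCLike.continuous_ofReal.comp_aestronglyMeasurable ?_
    exact ((q.aestronglyMeasurable.norm.sub
      (h : Ω →ₘ[μ] 𝕜).aestronglyMeasurable.norm).sup aestronglyMeasurable_const)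
  set p : Ω →ₘ[μ] 𝕜 := AEEqFun.mk _ hmeas with hp
  have hpx : ∀ᵐ x ∂μ, p x = ((max (‖q x‖ - ‖(h : Ω →ₘ[μ] 𝕜) x‖) 0 : ℝ) : 𝕜) :=
    AEEqFun.coeFn_mk _ hmeas
  have key : ∀ᶠ m in atTop, ∃ hpX : p ∈ X.carrier, ‖(⟨p, hpX⟩ : X.carrier)‖ ≤ ‖a m - h‖ := by
    filter_upwards [hq] with m hm
    refine X.ideal (a m - h) p ?_
    filter_upwards [hm, hpx, AEEqFun.coeFn_sub (a m : Ω →ₘ[μ] 𝕜) (h : Ω →ₘ[μ] 𝕜)] with x h1 h2 h3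
    rw [h2, RCLike.norm_ofReal, abs_of_nonneg (le_max_right _ _), Submodule.coe_sub, h3]
    refine max_le ?_ (norm_nonneg _)
    have := norm_sub_norm_le ((a m : Ω →ₘ[μ] 𝕜) x) ((h : Ω →ₘ[μ] 𝕜) x)
    simp only [Pi.sub_apply]
    linarith
  obtain ⟨hpX, -⟩ := key.exists.choose_spec
  have hle : ‖(⟨p, hpX⟩ : X.carrier)‖ ≤ 0 := by
    have ht : Tendsto (fun m => ‖a m - h‖) atTop (𝓝 0) := tendsto_iff_norm_sub_tendsto_zero.1 ha
    refine ge_of_tendsto ht ?_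
    filter_upwards [key] with m hm
    exact hm.2
  have hp0 : p = 0 := by
    have : (⟨p, hpX⟩ : X.carrier) = 0 := norm_le_zero_iff.1 hle
    simpa using congrArg Subtype.val this
  filter_upwards [hpx, AEEqFun.coeFn_zero (α := Ω) (μ := μ) (β := 𝕜)] with x h1 h2
  rw [hp0, h2] at h1
  have h3 : max (‖q x‖ - ‖(h : Ω →ₘ[μ] 𝕜) x‖) 0 = 0 := by
    have h4 : ((max (‖q x‖ - ‖(h : Ω →ₘ[μ] 𝕜) x‖) 0 : ℝ) : 𝕜) = 0 := by
      rw [← h1]; rfl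
    exact_mod_cast h4
  have := le_max_left (‖q x‖ - ‖(h : Ω →ₘ[μ] 𝕜) x‖) 0
  linarith

/-- `|f| ∈ X` with `‖|f|‖ ≤ ‖f‖`. -/
theorem exists_abs (X : BanachFunctionSpace 𝕜 μ) (f : X.carrier) :
    ∃ g : X.carrier, ‖g‖ ≤ ‖f‖ ∧
      ∀ᵐ x ∂μ, (g : Ω →ₘ[μ] 𝕜) x = ((‖(f : Ω →ₘ[μ] 𝕜) x‖ : ℝ) : 𝕜) := by
  have hmeas : AEStronglyMeasurable
      (fun x => ((‖(f : Ω →ₘ[μ] 𝕜) x‖ : ℝ) : 𝕜)) μ :=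
    RCLike.continuous_ofReal.comp_aestronglyMeasurable
      (f : Ω →ₘ[μ] 𝕜).aestronglyMeasurable.norm
  have hx := AEEqFun.coeFn_mk _ hmeas
  obtain ⟨hg, hle⟩ := X.ideal f (AEEqFun.mk _ hmeas) (by
    filter_upwards [hx] with x h1
    rw [h1]; simp)
  exact ⟨⟨_, hg⟩, hle, hx⟩

/-- The supremum defining the Köthe dual norm is finite. -/
theorem bddAbove_kothe (X : BanachFunctionSpace 𝕜 μ) (g : X.kotheSubmodule) :
    BddAbove {r : ℝ | ∃ f : X.carrier, ‖f‖ = 1 ∧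
      r = ∫ x, ‖(f : Ω →ₘ[μ] 𝕜) x * (g : Ω →ₘ[μ] 𝕜) x‖ ∂μ} := by
  have : CompleteSpace X.carrier := X.isComplete
  by_contra hb
  have hf : ∀ n : ℕ, ∃ f : X.carrier, ‖f‖ = 1 ∧
      (n : ℝ) * 2 ^ n < ∫ x, ‖(f : Ω →ₘ[μ] 𝕜) x * (g : Ω →ₘ[μ] 𝕜) x‖ ∂μ := by
    intro n
    obtain ⟨r, ⟨f, hf, rfl⟩, hr⟩ := not_bddAbove_iff.1 hb ((n : ℝ) * 2 ^ n)
    exact ⟨f, hf, hr⟩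
  choose f hf1 hf2 using hf
  choose e he1 he2 using fun n => X.exists_abs (f n)
  have hsum : Summable fun n => (((1 / 2 : ℝ) ^ n : ℝ) : 𝕜) • e n := by
    refine Summable.of_norm_bounded (g := fun n => (1 / 2 : ℝ) ^ n) summable_geometric_two ?_
    intro n
    rw [norm_smul, RCLike.norm_ofReal, abs_of_nonneg (by positivity)]
    have := he1 n
    rw [hf1 n] at this
    exact mul_le_of_le_one_right (by positivity) this
  obtain ⟨h, hh⟩ := hsum
  have hS : ∀ m, ∀ᵐ x ∂μ,
      ((∑ k ∈ Finset.range m, (((1 / 2 : ℝ) ^ k : ℝ) : 𝕜) • e k : X.carrier) : Ω →ₘ[μ] 𝕜) x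
        = ((∑ k ∈ Finset.range m, (1 / 2 : ℝ) ^ k * ‖(f k : Ω →ₘ[μ] 𝕜) x‖ : ℝ) : 𝕜) := by
    intro m
    induction m with
    | zero =>
      filter_upwards [AEEqFun.coeFn_zero (α := Ω) (μ := μ) (β := 𝕜)] with x hx
      simp [hx]
    | succ m ih =>
      rw [Finset.sum_range_succ, Submodule.coe_add, Submodule.coe_smul]
      filter_upwards [ih, he2 m, AEEqFun.coeFn_add
        ((∑ k ∈ Finset.range m, (((1 / 2 : ℝ) ^ k : ℝ) : 𝕜) • e k : X.carrier) : Ω →ₘ[μ] 𝕜)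
        ((((1 / 2 : ℝ) ^ m : ℝ) : 𝕜) • (e m : Ω →ₘ[μ] 𝕜)),
        AEEqFun.coeFn_smul (((1 / 2 : ℝ) ^ m : ℝ) : 𝕜) (e m : Ω →ₘ[μ] 𝕜)] with x h1 h2 h3 h4
      rw [h3, Pi.add_apply, h1, h4, Pi.smul_apply, h2, Finset.sum_range_succ]
      simp
  have hdom : ∀ n, ∀ᵐ x ∂μ,
      (1 / 2 : ℝ) ^ n * ‖(f n : Ω →ₘ[μ] 𝕜) x‖ ≤ ‖(h : Ω →ₘ[μ] 𝕜) x‖ := by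
    intro n
    have h0 := X.norm_le_of_tendsto _ h hh.tendsto_sum_nat
      ((((1 / 2 : ℝ) ^ n : ℝ) : 𝕜) • (f n : Ω →ₘ[μ] 𝕜)) (by
        filter_upwards [eventually_gt_atTop n] with m hm
        filter_upwards [hS m, AEEqFun.coeFn_smul (((1 / 2 : ℝ) ^ n : ℝ) : 𝕜)
          (f n : Ω →ₘ[μ] 𝕜)] with x h1 h2
        have hnn : ∀ k ∈ Finset.range m, 0 ≤ (1 / 2 : ℝ) ^ k * ‖(f k : Ω →ₘ[μ] 𝕜) x‖ :=
          fun k _ => by positivity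
        rw [h1, h2, Pi.smul_apply, norm_smul, RCLike.norm_ofReal, RCLike.norm_ofReal,
          abs_of_nonneg (by positivity), abs_of_nonneg (Finset.sum_nonneg hnn)]
        exact Finset.single_le_sum hnn (Finset.mem_range.2 hm))
    filter_upwards [h0, AEEqFun.coeFn_smul (((1 / 2 : ℝ) ^ n : ℝ) : 𝕜)
          (f n : Ω →ₘ[μ] 𝕜)] with x h1 h2
    rw [h2, Pi.smul_apply, norm_smul, RCLike.norm_ofReal, abs_of_nonneg (by positivity)] at h1
    exact h1
  obtain ⟨n, hn⟩ := exists_nat_gt (∫ x, ‖(h : Ω →ₘ[μ] 𝕜) x * (g : Ω →ₘ[μ] 𝕜) x‖ ∂μ)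
  have hle : (1 / 2 : ℝ) ^ n * ∫ x, ‖(f n : Ω →ₘ[μ] 𝕜) x * (g : Ω →ₘ[μ] 𝕜) x‖ ∂μ
      ≤ ∫ x, ‖(h : Ω →ₘ[μ] 𝕜) x * (g : Ω →ₘ[μ] 𝕜) x‖ ∂μ := by
    rw [← integral_const_mul]
    refine integral_mono_ae ((g.2 _ (f n).2).norm.const_mul _) (g.2 _ h.2).norm ?_
    filter_upwards [hdom n] with x hx
    simp only [norm_mul]
    rw [← mul_assoc]
    exact mul_le_mul_of_nonneg_right hx (norm_nonneg _)
  have h2 : (n : ℝ) = (1 / 2 : ℝ) ^ n * ((n : ℝ) * 2 ^ n) := by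
    rw [mul_left_comm, ← mul_pow]; norm_num
  have h3 := mul_lt_mul_of_pos_left (hf2 n) (show (0 : ℝ) < (1 / 2 : ℝ) ^ n by positivity)
  linarith

theorem kotheNorm_nonneg (X : BanachFunctionSpace 𝕜 μ) (g : X.kotheSubmodule) :
    0 ≤ X.kotheNorm g := by
  refine Real.sSup_nonneg ?_
  rintro r ⟨f, -, rfl⟩
  exact integral_nonneg fun x => norm_nonneg _

theorem integral_le_kotheNorm (X : BanachFunctionSpace 𝕜 μ) (g : X.kotheSubmodule)
    (f : X.carrier) (hf : ‖f‖ = 1) :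
    ∫ x, ‖(f : Ω →ₘ[μ] 𝕜) x * (g : Ω →ₘ[μ] 𝕜) x‖ ∂μ ≤ X.kotheNorm g :=
  le_csSup (X.bddAbove_kothe g) ⟨f, hf, rfl⟩

theorem kotheNorm_smul (X : BanachFunctionSpace 𝕜 μ) (c : 𝕜) (g : X.kotheSubmodule) :
    X.kotheNorm (c • g) = ‖c‖ * X.kotheNorm g := by
  have h1 : ∀ f : X.carrier,
      ∫ x, ‖(f : Ω →ₘ[μ] 𝕜) x * ((c • g : X.kotheSubmodule) : Ω →ₘ[μ] 𝕜) x‖ ∂μ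
        = ‖c‖ * ∫ x, ‖(f : Ω →ₘ[μ] 𝕜) x * (g : Ω →ₘ[μ] 𝕜) x‖ ∂μ := by
    intro f
    rw [← integral_const_mul]
    refine integral_congr_ae ?_
    filter_upwards [AEEqFun.coeFn_smul c (g : Ω →ₘ[μ] 𝕜)] with x hx
    rw [Submodule.coe_smul, hx, Pi.smul_apply, norm_mul, norm_smul, norm_mul]
    ring
  rw [kotheNorm, kotheNorm, ← smul_eq_mul, ← Real.sSup_smul_of_nonneg (norm_nonneg c)]
  congr 1
  ext r
  simp only [Set.mem_ofPred_eq, Set.mem_smul_set, h1, smul_eq_mul]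
  constructor
  · rintro ⟨f, hf, rfl⟩
    exact ⟨_, ⟨f, hf, rfl⟩, rfl⟩
  · rintro ⟨_, ⟨f, hf, rfl⟩, rfl⟩
    exact ⟨f, hf, rfl⟩

theorem kotheNorm_add_le (X : BanachFunctionSpace 𝕜 μ) (g h : X.kotheSubmodule) :
    X.kotheNorm (g + h) ≤ X.kotheNorm g + X.kotheNorm h := by
  refine Real.sSup_le ?_ (add_nonneg (X.kotheNorm_nonneg g) (X.kotheNorm_nonneg h))
  rintro r ⟨f, hf, rfl⟩
  refine le_trans ?_ (add_le_add (X.integral_le_kotheNorm g f hf) (X.integral_le_kotheNorm h f hf))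
  rw [← integral_add (g.2 _ f.2).norm (h.2 _ f.2).norm]
  refine integral_mono_ae ((g + h).2 _ f.2).norm ((g.2 _ f.2).norm.add (h.2 _ f.2).norm) ?_
  filter_upwards [AEEqFun.coeFn_add (g : Ω →ₘ[μ] 𝕜) (h : Ω →ₘ[μ] 𝕜)] with x hx
  simp only [Submodule.coe_add, hx, Pi.add_apply, mul_add]
  exact norm_add_le _ _

theorem kotheNorm_eq_zero_iff (X : BanachFunctionSpace 𝕜 μ) (g : X.kotheSubmodule) :
    X.kotheNorm g = 0 ↔ g = 0 := by
  constructor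
  · intro h0
    by_contra hg
    have hgx : ¬ ∀ᵐ x ∂μ, (g : Ω →ₘ[μ] 𝕜) x = 0 := by
      intro hx
      refine hg (Subtype.ext (AEEqFun.ext ?_))
      filter_upwards [hx, AEEqFun.coeFn_zero (α := Ω) (μ := μ) (β := 𝕜)] with x h1 h2
      rw [h1, Submodule.coe_zero, h2]; rfl
    have hE : MeasurableSet {x | (g : Ω →ₘ[μ] 𝕜) x ≠ 0} :=
      ((g : Ω →ₘ[μ] 𝕜).measurable (measurableSet_singleton (0 : 𝕜))).compl
    obtain ⟨F, hFE, hF, hF0, f, hfX, hfF⟩ :=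
      X.saturated _ hE (pos_iff_ne_zero.2 fun h => hgx (ae_iff.2 h))
    have hfne : (⟨f, hfX⟩ : X.carrier) ≠ 0 := by
      intro hf0
      have hf0' : f = 0 := congrArg Subtype.val hf0
      have : ∀ᵐ x ∂μ, x ∉ F := by
        filter_upwards [hfF, AEEqFun.coeFn_zero (α := Ω) (μ := μ) (β := 𝕜)] with x h1 h2 hxF
        rw [hf0', h2, Set.indicator_of_mem hxF] at h1
        exact zero_ne_one h1
      exact hF0.ne' (measure_eq_zero_iff_ae_notMem.2 this)
    have hn := norm_pos_iff.2 hfne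
    set c : 𝕜 := ((‖(⟨f, hfX⟩ : X.carrier)‖⁻¹ : ℝ) : 𝕜) with hc
    have hc0 : c ≠ 0 := by
      rw [hc]; exact_mod_cast (inv_pos.2 hn).ne'
    have h1 : ‖c • (⟨f, hfX⟩ : X.carrier)‖ = 1 := by
      rw [norm_smul, hc, RCLike.norm_ofReal, abs_of_pos (inv_pos.2 hn), inv_mul_cancel₀ hn.ne']
    have h2 := X.integral_le_kotheNorm g _ h1
    rw [h0] at h2
    have h3 := le_antisymm h2 (integral_nonneg fun x => norm_nonneg _)
    rw [integral_eq_zero_iff_of_nonneg (fun x => norm_nonneg _)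
      (g.2 _ (c • (⟨f, hfX⟩ : X.carrier)).2).norm] at h3
    have : ∀ᵐ x ∂μ, x ∉ F := by
      filter_upwards [h3, hfF, AEEqFun.coeFn_smul c f] with x h4 h5 h6 hxF
      simp only [Submodule.coe_smul, h6, Pi.smul_apply, h5, Set.indicator_of_mem hxF,
        Pi.zero_apply, norm_eq_zero, smul_eq_mul, mul_one, mul_eq_zero] at h4
      exact h4.elim hc0 (hFE hxF)
    exact hF0.ne' (measure_eq_zero_iff_ae_notMem.2 this)
  · rintro rfl
    have := X.kotheNorm_smul 0 0
    simpa using this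

/-- The Köthe dual `X'` with its norm. -/
def kotheDual (X : BanachFunctionSpace 𝕜 μ) : NormedFunctionSpace 𝕜 μ where
  carrier := X.kotheSubmodule
  nrm := X.kotheNorm
  nrm_nonneg := X.kotheNorm_nonneg
  nrm_smul := X.kotheNorm_smul
  nrm_add_le := X.kotheNorm_add_le
  nrm_eq_zero_iff := X.kotheNorm_eq_zero_iff

end BanachFunctionSpace

end

/-!
The proof works with spaces `N ⊆ L⁰` that have the ideal property, so that it applies to `X` and to
its Köthe dual `X'` alike.

*Order-continuity from weak convergence.* If `fₙ ↓ 0` a.e. and `fₙ → 0` weakly, then `‖fₙ‖ → 0`: the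
convex set `{h | ∃ m, f_m ≤ Re h}` has `0` in its weak closure, hence in its norm closure, and every
small element of it dominates some `f_m` (`HasIdealProperty.tendsto_norm_of_weak`). Order relations
survive weak limits because they cut out closed convex sets (`mem_of_tendsto_weak`).

*Duality.* `X` contains a function `w > 0` (`exists_weak_unit`). If `X` is order-continuous, then
`A ↦ φ (w 1_A)` is countably additive for every `φ ∈ X*`, and the Radon–Nikodym theorem represents
`φ` as integration against a function (`IsOrderContinuous.exists_integral_repr`). Hence `X* = X'`
isometrically (`kotheEquivDual`). In particular `X'` is complete, and it is saturated because `X*`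
separates points; so `X'` is again a Banach function space.

*Reflexive spaces.* Bounded sequences converge weakly along an ultrafilter. For `fₙ ↓ 0` the limit
lies below every `fₙ`, so it is `0`, and `X` is order-continuous. For `0 ≤ fₙ ↑ g` the limit lies
above `g`, so `g ∈ X`, and `‖fₙ‖ → ‖g‖` by order-continuity. Functionals on `X' = X*` are
evaluations at elements of `X`, so `gₙ ↓ 0` in `X'` implies `gₙ → 0` weakly by dominated
convergence.

*Converse.* If `X` and `X'` are order-continuous, then `Φ ∈ X**` is a functional on `X' = X*`, hence
integration against some `h`. The truncations `min (|h|, n w) ∈ X` have norm at most `‖Φ‖`, and the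
Fatou property gives `h ∈ X` (`mem_carrier_of_integral_repr`).
-/

noncomputable section

/-! ### Weak limits and closed convex sets -/

theorem RCLike.norm_eq_re_of_nonneg {𝕜 : Type*} [RCLike 𝕜] {z : 𝕜} (hz : 0 ≤ z) :
    ‖z‖ = RCLike.re z := by
  have := RCLike.norm_of_nonneg' hz
  have := congrArg RCLike.re this
  simpa using this

/-- A norm-closed convex subset of a normed space is closed under limits in the weak topology. -/
theorem mem_of_tendsto_weak {𝕜 E ι : Type*} [RCLike 𝕜] [NormedAddCommGroup E] [NormedSpace 𝕜 E]
    {C : Set E} (hC : IsClosed C)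
    (hconv : ∀ a ∈ C, ∀ b ∈ C, ∀ s t : ℝ, 0 ≤ s → 0 ≤ t → s + t = 1 →
      (s : 𝕜) • a + (t : 𝕜) • b ∈ C)
    {l : Filter ι} [l.NeBot] {x : ι → E} {y : E} (hx : ∀ᶠ i in l, x i ∈ C)
    (hw : ∀ φ : StrongDual 𝕜 E, Tendsto (fun i => φ (x i)) l (𝓝 (φ y))) : y ∈ C := by
  let _ : NormedSpace ℝ E := NormedSpace.restrictScalars ℝ 𝕜 E
  have : IsScalarTower ℝ 𝕜 E := ⟨fun r k x => by
    change (r • k) • x = (algebraMap ℝ 𝕜 r) • k • x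
    rw [Algebra.smul_def, mul_smul]⟩
  have hconv' : Convex ℝ C := by
    intro a ha b hb s t hs ht hst
    have := hconv a ha b hb s t hs ht hst
    rwa [← algebraMap_smul 𝕜 s a, ← algebraMap_smul 𝕜 t b]
  by_contra hy
  obtain ⟨φ, u, h1, h2⟩ := RCLike.geometric_hahn_banach_point_closed (𝕜 := 𝕜) hconv' hC hy
  have h3 : Tendsto (fun i => RCLike.re (φ (x i))) l (𝓝 (RCLike.re (φ y))) :=
    (RCLike.continuous_re.tendsto _).comp (hw φ)
  have h4 : u ≤ RCLike.re (φ y) := ge_of_tendsto h3 (hx.mono fun i hi => (h2 _ hi).le)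
  linarith

/-- In a reflexive space, bounded sequences converge weakly along an ultrafilter
(Banach–Alaoglu in the bidual). -/
theorem exists_tendsto_weak_of_reflexive {𝕜 E : Type*} [RCLike 𝕜] [NormedAddCommGroup E]
    [NormedSpace 𝕜 E] (hE : Function.Surjective (NormedSpace.inclusionInDoubleDual 𝕜 E))
    {f : ℕ → E} {C : ℝ} (hf : ∀ n, ‖f n‖ ≤ C) :
    ∃ y : E, ∀ φ : StrongDual 𝕜 E,
      Tendsto (fun n => φ (f n)) (hyperfilter ℕ) (𝓝 (φ y)) := by
  have hK := WeakDual.isCompact_closedBall (𝕜 := 𝕜) (0 : StrongDual 𝕜 (StrongDual 𝕜 E)) C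
  set x : ℕ → WeakDual 𝕜 (StrongDual 𝕜 E) := fun n =>
    StrongDual.toWeakDual (NormedSpace.inclusionInDoubleDual 𝕜 E (f n))
  obtain ⟨Ψ, -, hΨ⟩ := hK.ultrafilter_le_nhds ((hyperfilter ℕ).map x) (by
    rw [le_principal_iff, Ultrafilter.mem_coe, Ultrafilter.mem_map]
    refine Filter.univ_mem' fun n => ?_
    exact (mem_closedBall_zero_iff (E := StrongDual 𝕜 (StrongDual 𝕜 E))).2
      ((NormedSpace.double_dual_bound 𝕜 E (f n)).trans (hf n)))
  obtain ⟨y, hy⟩ := hE (WeakDual.toStrongDual Ψ)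
  refine ⟨y, fun φ => ?_⟩
  have h1 : φ y = Ψ φ := by
    rw [← NormedSpace.dual_def 𝕜 E y φ, hy]
    rfl
  rw [h1]
  exact ((WeakDual.eval_continuous φ).tendsto Ψ).comp hΨ

theorem hyperfilter_eventually_ge (n : ℕ) : ∀ᶠ k in (hyperfilter ℕ : Filter ℕ), n ≤ k :=
  Nat.hyperfilter_le_atTop (eventually_ge_atTop n)

/-! ### Spaces with the ideal property -/

namespace NormedFunctionSpace

variable {𝕜 : Type*} [RCLike 𝕜] {Ω : Type*} [MeasurableSpace Ω] {μ : Measure Ω}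
  {N : NormedFunctionSpace 𝕜 μ}

theorem coe_add_ae (f g : N.carrier) :
    ∀ᵐ x ∂μ, ((f + g : N.carrier) : Ω →ₘ[μ] 𝕜) x
      = (f : Ω →ₘ[μ] 𝕜) x + (g : Ω →ₘ[μ] 𝕜) x :=
  AEEqFun.coeFn_add (f : Ω →ₘ[μ] 𝕜) g

theorem coe_sub_ae (f g : N.carrier) :
    ∀ᵐ x ∂μ, ((f - g : N.carrier) : Ω →ₘ[μ] 𝕜) x
      = (f : Ω →ₘ[μ] 𝕜) x - (g : Ω →ₘ[μ] 𝕜) x :=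
  AEEqFun.coeFn_sub (f : Ω →ₘ[μ] 𝕜) g

theorem coe_smul_ae (c : 𝕜) (f : N.carrier) :
    ∀ᵐ x ∂μ, ((c • f : N.carrier) : Ω →ₘ[μ] 𝕜) x = c * (f : Ω →ₘ[μ] 𝕜) x :=
  AEEqFun.coeFn_smul c (f : Ω →ₘ[μ] 𝕜)

theorem coe_zero_ae : ∀ᵐ x ∂μ, ((0 : N.carrier) : Ω →ₘ[μ] 𝕜) x = 0 :=
  AEEqFun.coeFn_zero (α := Ω) (μ := μ) (β := 𝕜)

theorem ext_ae {f g : N.carrier}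
    (h : ∀ᵐ x ∂μ, (f : Ω →ₘ[μ] 𝕜) x = (g : Ω →ₘ[μ] 𝕜) x) : f = g :=
  Subtype.ext (AEEqFun.ext h)

theorem HasIdealProperty.norm_le (hN : N.HasIdealProperty) {f g : N.carrier}
    (h : ∀ᵐ x ∂μ, ‖(g : Ω →ₘ[μ] 𝕜) x‖ ≤ ‖(f : Ω →ₘ[μ] 𝕜) x‖) : ‖g‖ ≤ ‖f‖ :=
  (hN f g h).choose_spec

/-- The ideal property for honest functions in place of their classes. -/
theorem HasIdealProperty.exists_of_norm_le (hN : N.HasIdealProperty) (f : N.carrier) {u : Ω → 𝕜}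
    (hu : AEStronglyMeasurable u μ) (h : ∀ᵐ x ∂μ, ‖u x‖ ≤ ‖(f : Ω →ₘ[μ] 𝕜) x‖) :
    ∃ v : N.carrier, ‖v‖ ≤ ‖f‖ ∧ ∀ᵐ x ∂μ, (v : Ω →ₘ[μ] 𝕜) x = u x := by
  have hx := AEEqFun.coeFn_mk u hu
  obtain ⟨hv, hle⟩ := hN f (AEEqFun.mk u hu) (by
    filter_upwards [hx, h] with x h1 h2
    rwa [h1])
  exact ⟨⟨_, hv⟩, hle, hx⟩

/-- A pointwise a.e. upper bound on a nonexpansive function of `h x` defines a norm-closed set: the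
positive part of the excess at a limit is dominated by the distance to the approximants. -/
theorem HasIdealProperty.isClosed_setOf_ae_le (hN : N.HasIdealProperty) {ψ : 𝕜 → ℝ}
    (hψ : ∀ z w, ψ z - ψ w ≤ ‖z - w‖) (hψc : Continuous ψ) {q : Ω → ℝ}
    (hq : AEStronglyMeasurable q μ) :
    IsClosed {h : N.carrier | ∀ᵐ x ∂μ, ψ ((h : Ω →ₘ[μ] 𝕜) x) ≤ q x} := by
  rw [← isSeqClosed_iff_isClosed]
  intro a h ha hah
  set u : Ω → 𝕜 := fun x => ((max (ψ ((h : Ω →ₘ[μ] 𝕜) x) - q x) 0 : ℝ) : 𝕜) with hu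
  have humeas : AEStronglyMeasurable u μ :=
    RCLike.continuous_ofReal.comp_aestronglyMeasurable
      (((hψc.comp_aestronglyMeasurable (h : Ω →ₘ[μ] 𝕜).aestronglyMeasurable).sub hq).sup
        aestronglyMeasurable_const)
  have hle : ∀ m, ∀ᵐ x ∂μ, ‖u x‖ ≤ ‖((a m - h : N.carrier) : Ω →ₘ[μ] 𝕜) x‖ := by
    intro m
    filter_upwards [ha m, coe_sub_ae (a m) h] with x h1 h2
    rw [h2, hu, RCLike.norm_ofReal, abs_of_nonneg (le_max_right _ _)]
    refine max_le ?_ (norm_nonneg _)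
    have := hψ ((h : Ω →ₘ[μ] 𝕜) x) ((a m : Ω →ₘ[μ] 𝕜) x)
    rw [norm_sub_rev] at this
    linarith
  obtain ⟨v, -, hv⟩ := hN.exists_of_norm_le (a 0 - h) humeas (hle 0)
  have hv0 : v = 0 := by
    refine norm_le_zero_iff.1 (ge_of_tendsto' (tendsto_iff_norm_sub_tendsto_zero.1 hah) fun m => ?_)
    refine hN.norm_le ?_
    filter_upwards [hle m, hv] with x h1 h2
    rwa [h2]
  filter_upwards [hv, coe_zero_ae (N := N)] with x h1 h2
  rw [hv0, h2] at h1
  have h3 : max (ψ ((h : Ω →ₘ[μ] 𝕜) x) - q x) 0 = 0 := by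
    have h4 : ((max (ψ ((h : Ω →ₘ[μ] 𝕜) x) - q x) 0 : ℝ) : 𝕜) = 0 := h1.symm
    exact_mod_cast h4
  have := le_max_left (ψ ((h : Ω →ₘ[μ] 𝕜) x) - q x) 0
  linarith

theorem HasIdealProperty.isClosed_setOf_norm_le (hN : N.HasIdealProperty) (f : Ω →ₘ[μ] 𝕜) :
    IsClosed {h : N.carrier | ∀ᵐ x ∂μ, ‖(h : Ω →ₘ[μ] 𝕜) x‖ ≤ ‖f x‖} :=
  hN.isClosed_setOf_ae_le (fun z w => norm_sub_norm_le z w) continuous_norm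
    f.aestronglyMeasurable.norm

theorem HasIdealProperty.isClosed_setOf_le_re (hN : N.HasIdealProperty) (f : Ω →ₘ[μ] 𝕜) :
    IsClosed {h : N.carrier | ∀ᵐ x ∂μ, RCLike.re (f x) ≤ RCLike.re ((h : Ω →ₘ[μ] 𝕜) x)} := by
  have := hN.isClosed_setOf_ae_le (ψ := fun z => -RCLike.re z) (q := fun x => -RCLike.re (f x))
    (fun z w => by
      have := RCLike.re_le_norm (w - z)
      rw [norm_sub_rev, map_sub] at this
      linarith) (by fun_prop)
    (RCLike.continuous_re.comp_aestronglyMeasurable f.aestronglyMeasurable).neg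
  simpa only [neg_le_neg_iff] using this

/-- A sequence with `fₙ ↓ 0` a.e. that tends to `0` weakly tends to `0` in norm: the upper set
`{h | ∃ m, f_m ≤ Re h}` is convex, so `0` lies in its norm closure, and every small element of it
dominates some `f_m`. -/
theorem HasIdealProperty.tendsto_norm_of_weak (hN : N.HasIdealProperty) {f : ℕ → N.carrier}
    (hf : ∀ᵐ x ∂μ, Antitone fun n => (f n : Ω →ₘ[μ] 𝕜) x)
    (hf0 : ∀ᵐ x ∂μ, Tendsto (fun n => (f n : Ω →ₘ[μ] 𝕜) x) atTop (𝓝 0))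
    {l : Filter ℕ} [l.NeBot]
    (hw : ∀ φ : StrongDual 𝕜 N.carrier, Tendsto (fun n => φ (f n)) l (𝓝 0)) :
    Antitone (fun n => ‖f n‖) ∧ Tendsto (fun n => ‖f n‖) atTop (𝓝 0) := by
  have hnn : ∀ᵐ x ∂μ, ∀ n, 0 ≤ (f n : Ω →ₘ[μ] 𝕜) x := by
    filter_upwards [hf, hf0] with x h1 h2 n
    exact h1.le_of_tendsto h2 n
  have hanti : Antitone fun n => ‖f n‖ := by
    intro m n hmn
    refine hN.norm_le ?_
    filter_upwards [hf, hnn] with x h1 h2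
    rw [RCLike.norm_eq_re_of_nonneg (h2 n), RCLike.norm_eq_re_of_nonneg (h2 m)]
    exact (RCLike.le_iff_re_im.1 (h1 hmn)).1
  refine ⟨hanti, ?_⟩
  set S : Set N.carrier := {h | ∃ m, ∀ᵐ x ∂μ,
    RCLike.re ((f m : Ω →ₘ[μ] 𝕜) x) ≤ RCLike.re ((h : Ω →ₘ[μ] 𝕜) x)} with hS
  have hSconv : ∀ a ∈ S, ∀ b ∈ S, ∀ s t : ℝ, 0 ≤ s → 0 ≤ t → s + t = 1 →
      (s : 𝕜) • a + (t : 𝕜) • b ∈ S := by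
    rintro a ⟨m, hm⟩ b ⟨n, hn⟩ s t hs ht hst
    refine ⟨max m n, ?_⟩
    filter_upwards [hm, hn, hf, coe_add_ae ((s : 𝕜) • a) ((t : 𝕜) • b), coe_smul_ae (s : 𝕜) a,
      coe_smul_ae (t : 𝕜) b] with x h1 h2 h3 h4 h5 h6
    rw [h4, h5, h6, map_add, RCLike.re_ofReal_mul, RCLike.re_ofReal_mul]
    have h7 := (RCLike.le_iff_re_im.1 (h3 (le_max_left m n))).1
    have h8 := (RCLike.le_iff_re_im.1 (h3 (le_max_right m n))).1
    have e : t = 1 - s := by linarith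
    subst e
    nlinarith
  have h0 : (0 : N.carrier) ∈ closure S := by
    refine mem_of_tendsto_weak (𝕜 := 𝕜) isClosed_closure ?_ (l := l) (x := f)
      (Eventually.of_forall fun n => subset_closure ⟨n, Eventually.of_forall fun x => le_rfl⟩)
      (fun φ => by simpa using hw φ)
    intro a ha b hb s t hs ht hst
    have hc : Continuous fun p : N.carrier × N.carrier => (s : 𝕜) • p.1 + (t : 𝕜) • p.2 := by
      fun_prop
    exact map_mem_closure₂ (f := fun a b => (s : 𝕜) • a + (t : 𝕜) • b) hc ha hb
      fun a ha b hb => hSconv a ha b hb s t hs ht hst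
  rw [Metric.tendsto_atTop]
  intro ε hε
  obtain ⟨h, ⟨m, hm⟩, hd⟩ := Metric.mem_closure_iff.1 h0 ε hε
  rw [dist_zero_left] at hd
  refine ⟨m, fun n hn => ?_⟩
  rw [Real.dist_0_eq_abs, abs_of_nonneg (norm_nonneg _)]
  refine ((hanti hn).trans ?_).trans_lt hd
  refine hN.norm_le ?_
  filter_upwards [hm, hnn] with x h1 h2
  rw [RCLike.norm_eq_re_of_nonneg (h2 m)]
  exact h1.trans (RCLike.re_le_norm _)

end NormedFunctionSpace

/-! ### Weak units -/

namespace BanachFunctionSpace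

variable {𝕜 : Type*} [RCLike 𝕜] {Ω : Type*} [MeasurableSpace Ω] {μ : Measure Ω}

open NormedFunctionSpace

/-- By completeness, the supports of countably many elements of `X` are contained, up to null sets,
in the support of a single element `∑ cₙ |fₙ|`. -/
theorem exists_forall_support_subset (X : BanachFunctionSpace 𝕜 μ) (f : ℕ → X.carrier) :
    ∃ h : X.carrier, ∀ n, ∀ᵐ x ∂μ, (f n : Ω →ₘ[μ] 𝕜) x ≠ 0 → (h : Ω →ₘ[μ] 𝕜) x ≠ 0 := by
  have : CompleteSpace X.carrier := X.isComplete
  choose e he1 he2 using fun n => X.exists_abs (f n)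
  set c : ℕ → ℝ := fun n => (1 / 2) ^ n / (1 + ‖f n‖) with hc
  have hcpos : ∀ n, 0 < c n := fun n => by positivity
  have hsum : Summable fun n => (c n : 𝕜) • e n := by
    refine Summable.of_norm_bounded (g := fun n => (1 / 2 : ℝ) ^ n) summable_geometric_two ?_
    intro n
    rw [norm_smul, RCLike.norm_ofReal, abs_of_pos (hcpos n), hc, div_mul_eq_mul_div,
      div_le_iff₀ (by positivity)]
    have := he1 n
    gcongr
    linarith
  obtain ⟨h, hh⟩ := hsum
  have hterm : ∀ n, ∀ᵐ x ∂μ, (((c n : 𝕜) • e n : X.carrier) : Ω →ₘ[μ] 𝕜) x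
      = ((c n * ‖(f n : Ω →ₘ[μ] 𝕜) x‖ : ℝ) : 𝕜) := by
    intro n
    filter_upwards [coe_smul_ae (c n : 𝕜) (e n), he2 n] with x h1 h2
    rw [h1, h2, RCLike.ofReal_mul]
  have hnn : ∀ s : Finset ℕ, ∀ᵐ x ∂μ,
      0 ≤ RCLike.re (((∑ k ∈ s, (c k : 𝕜) • e k : X.carrier) : Ω →ₘ[μ] 𝕜) x) := by
    intro s
    induction s using Finset.induction_on with
    | empty =>
      filter_upwards [coe_zero_ae (N := X.toNormedFunctionSpace)] with x hx
      rw [Finset.sum_empty, hx, map_zero]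
    | insert k s hk ih =>
      rw [Finset.sum_insert hk]
      filter_upwards [ih, hterm k, coe_add_ae ((c k : 𝕜) • e k) (∑ k ∈ s, (c k : 𝕜) • e k)]
        with x h1 h2 h3
      rw [h3, h2, map_add, RCLike.ofReal_re]
      have := (hcpos k).le
      positivity
  refine ⟨h, fun n => ?_⟩
  have hmem := (X.ideal.isClosed_setOf_le_re ((c n : 𝕜) • e n : X.carrier)).mem_of_tendsto hh (by
    filter_upwards [eventually_ge_atTop {n}] with s hs
    rw [← Finset.add_sum_erase s _ (Finset.singleton_subset_iff.1 hs)]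
    filter_upwards [hnn (s.erase n), coe_add_ae ((c n : 𝕜) • e n)
      (∑ k ∈ s.erase n, (c k : 𝕜) • e k)] with x h1 h2
    rw [h2, map_add]
    linarith)
  filter_upwards [hmem, hterm n] with x h1 h2 h3 h4
  rw [h2, h4, RCLike.ofReal_re, map_zero] at h1
  have := mul_pos (hcpos n) (norm_pos_iff.2 h3)
  linarith

/-- A Banach function space over a `σ`-finite measure space has a weak unit: an element that is
strictly positive a.e. It is an element whose support has the largest possible measure. -/
theorem exists_weak_unit [SigmaFinite μ] (X : BanachFunctionSpace 𝕜 μ) :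
    ∃ (w : X.carrier) (ω : Ω → ℝ), Measurable ω ∧ (∀ x, 0 < ω x) ∧
      ∀ᵐ x ∂μ, (w : Ω →ₘ[μ] 𝕜) x = (ω x : 𝕜) := by
  set P : Measure Ω := μ.toFinite with hP
  set S : X.carrier → Set Ω := fun f => {x | (f : Ω →ₘ[μ] 𝕜) x ≠ 0} with hS
  have hSm : ∀ f, MeasurableSet (S f) := fun f =>
    ((f : Ω →ₘ[μ] 𝕜).measurable (measurableSet_singleton (0 : 𝕜))).compl
  obtain ⟨u, -, hu, hmem⟩ := exists_seq_tendsto_sSup (S := Set.range fun f => P (S f))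
    ⟨_, ⟨0, rfl⟩⟩ (OrderTop.bddAbove _)
  choose f hf using hmem
  obtain ⟨h, hh⟩ := X.exists_forall_support_subset f
  have hmax : ∀ g : X.carrier, P (S g) ≤ P (S h) := by
    intro g
    refine (le_sSup (Set.mem_range_self g)).trans (le_of_tendsto' hu fun n => ?_)
    rw [← hf n]
    refine measure_mono_ae ?_
    have : P ≪ μ := toFinite_absolutelyContinuous μ
    filter_upwards [this.ae_le (hh n)] with x hx using hx
  have hfull : μ (S h)ᶜ = 0 := by
    by_contra hne
    obtain ⟨F, hFS, hF, hF0, g, hgX, hgF⟩ := X.saturated _ (hSm h).compl (pos_iff_ne_zero.2 hne)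
    obtain ⟨k, hk⟩ := X.exists_forall_support_subset fun n => if n = 0 then h else ⟨g, hgX⟩
    have h0 := hk 0
    have h1 := hk 1
    simp only [if_true, one_ne_zero, if_false] at h0 h1
    have hsub : ∀ᵐ x ∂P, x ∈ S h ∪ F → x ∈ S k := by
      refine (toFinite_absolutelyContinuous μ).ae_le ?_
      filter_upwards [h0, h1, hgF] with x h2 h3 h4 hx
      rcases hx with hx | hx
      · exact h2 hx
      · refine h3 ?_
        rw [h4, Set.indicator_of_mem hx]
        exact one_ne_zero
    have hle : P (S h ∪ F) ≤ P (S h) := (measure_mono_ae hsub).trans (hmax k)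
    rw [measure_union (Set.disjoint_left.2 fun x hx hxF => hFS hxF hx) hF] at hle
    have hPF : P F = 0 := by
      by_contra hPF
      exact (ENNReal.lt_add_right (measure_ne_top P _) hPF).not_ge hle
    exact hF0.ne' (absolutelyContinuous_toFinite μ hPF)
  obtain ⟨w, -, hw⟩ := X.exists_abs h
  refine ⟨w, fun x => if (h : Ω →ₘ[μ] 𝕜) x = 0 then 1 else ‖(h : Ω →ₘ[μ] 𝕜) x‖, ?_, ?_, ?_⟩
  · exact Measurable.ite (by simpa [hS, Set.compl_ofPred] using (hSm h).compl) measurable_const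
      (h : Ω →ₘ[μ] 𝕜).measurable.norm
  · intro x
    dsimp only
    split_ifs with hx
    · exact one_pos
    · exact norm_pos_iff.2 hx
  · filter_upwards [hw, measure_eq_zero_iff_ae_notMem.1 hfull] with x h1 h2
    rw [h1, if_neg fun h3 => h2 fun h4 => h4 h3]

end BanachFunctionSpace

/-! ### Integral representation of functionals -/

namespace NormedFunctionSpace

variable {𝕜 : Type*} [RCLike 𝕜] {Ω : Type*} [MeasurableSpace Ω] {μ : Measure Ω}
  {N : NormedFunctionSpace 𝕜 μ}

/-- Order-continuity applied to `f - eₙ ↓ 0`. -/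
theorem IsOrderContinuous.tendsto_of_monotone (hO : N.IsOrderContinuous) {e : ℕ → N.carrier}
    {f : N.carrier} (he : ∀ᵐ x ∂μ, Monotone fun n => (e n : Ω →ₘ[μ] 𝕜) x)
    (hef : ∀ᵐ x ∂μ, Tendsto (fun n => (e n : Ω →ₘ[μ] 𝕜) x) atTop (𝓝 ((f : Ω →ₘ[μ] 𝕜) x))) :
    Tendsto e atTop (𝓝 f) := by
  have hsub : ∀ᵐ x ∂μ, ∀ n, ((f - e n : N.carrier) : Ω →ₘ[μ] 𝕜) x
      = (f : Ω →ₘ[μ] 𝕜) x - (e n : Ω →ₘ[μ] 𝕜) x := ae_all_iff.2 fun n => coe_sub_ae f (e n)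
  have h := (hO (fun n => f - e n) ?_ ?_).2
  · rw [tendsto_iff_norm_sub_tendsto_zero]
    simpa only [norm_sub_rev] using h
  · filter_upwards [he, hsub] with x h1 h2 m n hmn
    dsimp only
    rw [h2, h2]
    exact sub_le_sub_left (h1 hmn) _
  · filter_upwards [hef, hsub] with x h1 h2
    simp only [h2]
    simpa using h1.const_sub ((f : Ω →ₘ[μ] 𝕜) x)

theorem HasIdealProperty.exists_indicator (hN : N.HasIdealProperty) {w : N.carrier} {ω : Ω → ℝ}
    (hω : Measurable ω) (hw : ∀ᵐ x ∂μ, (w : Ω →ₘ[μ] 𝕜) x = (ω x : 𝕜)) {A : Set Ω}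
    (hA : MeasurableSet A) :
    ∃ v : N.carrier, ∀ᵐ x ∂μ, (v : Ω →ₘ[μ] 𝕜) x = A.indicator (fun x => (ω x : 𝕜)) x := by
  obtain ⟨v, -, hv⟩ := hN.exists_of_norm_le w (u := A.indicator fun x => (ω x : 𝕜))
    ((RCLike.measurable_ofReal.comp hω).indicator hA).aestronglyMeasurable (by
      filter_upwards [hw] with x hx
      rw [hx]
      exact norm_indicator_le_norm_self _ _)
  exact ⟨v, hv⟩

/-- If `N` is order-continuous, then `A ↦ Re φ (w 1_A)` is a signed measure absolutely continuous
with respect to `μ`, so it has a density by the Radon–Nikodym theorem. -/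
theorem IsOrderContinuous.exists_density [SigmaFinite μ] (hO : N.IsOrderContinuous)
    (hN : N.HasIdealProperty) {w : N.carrier} {ω : Ω → ℝ} (hω : Measurable ω)
    (hω0 : ∀ x, 0 < ω x) (hw : ∀ᵐ x ∂μ, (w : Ω →ₘ[μ] 𝕜) x = (ω x : 𝕜))
    (φ : StrongDual 𝕜 N.carrier) :
    ∃ ρ : Ω → ℝ, Measurable ρ ∧ Integrable ρ μ ∧ ∀ A, MeasurableSet A → ∀ e : N.carrier,
      (∀ᵐ x ∂μ, (e : Ω →ₘ[μ] 𝕜) x = A.indicator (fun x => (ω x : 𝕜)) x) →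
      RCLike.re (φ e) = ∫ x in A, ρ x ∂μ := by
  classical
  choose! v hv using fun (A : Set Ω) (hA : MeasurableSet A) => hN.exists_indicator hω hw hA
  have hv0 : ∀ A, μ A = 0 → MeasurableSet A → v A = 0 := by
    intro A hA hAm
    refine ext_ae ?_
    filter_upwards [hv A hAm, coe_zero_ae (N := N), measure_eq_zero_iff_ae_notMem.1 hA]
      with x h1 h2 h3
    rw [h1, h2, Set.indicator_of_notMem h3]
  let ν : SignedMeasure Ω :=
    { measureOf' := fun A => if MeasurableSet A then RCLike.re (φ (v A)) else 0
      empty' := by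
        rw [if_pos MeasurableSet.empty, hv0 ∅ measure_empty MeasurableSet.empty, map_zero, map_zero]
      not_measurable' := fun A hA => if_neg hA
      m_iUnion' := by
        intro A hA hd
        have hU : MeasurableSet (⋃ i, A i) := MeasurableSet.iUnion hA
        -- the tails of the union decrease to the empty set
        set T : ℕ → Set Ω := fun n => ⋃ i, ⋃ (_ : n ≤ i), A i with hT
        have hTm : ∀ n, MeasurableSet (T n) := fun n =>
          MeasurableSet.iUnion fun i => MeasurableSet.iUnion fun _ => hA i
        have hvT : ∀ᵐ x ∂μ, ∀ n, (v (T n) : Ω →ₘ[μ] 𝕜) x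
            = (T n).indicator (fun x => (ω x : 𝕜)) x := ae_all_iff.2 fun n => hv _ (hTm n)
        have hlim := (hO (fun n => v (T n)) (by
          filter_upwards [hvT] with x hx m n hmn
          dsimp only
          rw [hx, hx]
          refine Set.indicator_le_indicator_of_subset ?_
            (fun x => RCLike.ofReal_nonneg.2 (hω0 x).le) x
          exact Set.iUnion_mono fun i => Set.iUnion_mono' fun hi => ⟨hmn.trans hi, le_rfl⟩) (by
          filter_upwards [hvT] with x hx
          simp only [hx]
          refine tendsto_const_nhds.congr' ?_
          by_cases h : ∃ i, x ∈ A i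
          · obtain ⟨i, hi⟩ := h
            filter_upwards [eventually_gt_atTop i] with n hn
            rw [Set.indicator_of_notMem]
            simp only [hT, Set.mem_iUnion, not_exists]
            intro j hj hxj
            exact Set.disjoint_left.1 (hd (show i ≠ j by omega)) hi hxj
          · refine Eventually.of_forall fun n => ?_
            dsimp only
            rw [Set.indicator_of_notMem]
            simp only [hT, Set.mem_iUnion, not_exists]
            exact fun j _ hj => h ⟨j, hj⟩)).2
        simp only [hA, hU, if_true]
        have hS : ∀ s : Finset ℕ, ∀ᵐ x ∂μ, ((∑ i ∈ s, v (A i) : N.carrier) : Ω →ₘ[μ] 𝕜) x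
            = ∑ i ∈ s, (A i).indicator (fun x => (ω x : 𝕜)) x := by
          intro s
          induction s using Finset.induction_on with
          | empty => simpa only [Finset.sum_empty] using coe_zero_ae (N := N)
          | insert k s hk ih =>
            simp only [Finset.sum_insert hk]
            filter_upwards [ih, hv _ (hA k), coe_add_ae (v (A k)) (∑ i ∈ s, v (A i))]
              with x h1 h2 h3
            rw [h3, h1, h2]
        have hsum : HasSum (fun i => v (A i)) (v (⋃ i, A i)) := by
          rw [HasSum, SummationFilter.unconditional_filter, Metric.tendsto_atTop]
          intro ε hε
          obtain ⟨n, hn⟩ := (hlim.eventually (gt_mem_nhds hε)).exists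
          refine ⟨Finset.range n, fun s hs => lt_of_le_of_lt ?_ hn⟩
          rw [dist_eq_norm]
          refine hN.norm_le ?_
          filter_upwards [coe_sub_ae (∑ i ∈ s, v (A i)) (v (⋃ i, A i)), hS s, hv _ hU, hvT]
            with x h1 h2 h3 h4
          rw [h1, h2, h3, h4]
          have h5 := congrFun (Finset.indicator_biUnion s A (f := fun x => (ω x : 𝕜))
            fun i _ j _ hij => hd hij) x
          rw [← h5]
          by_cases hx : x ∈ ⋃ i, A i
          · by_cases hxs : x ∈ ⋃ i ∈ s, A i
            · rw [Set.indicator_of_mem hx, Set.indicator_of_mem hxs, sub_self, norm_zero]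
              exact norm_nonneg _
            · rw [Set.indicator_of_mem hx, Set.indicator_of_notMem hxs, zero_sub, norm_neg,
                Set.indicator_of_mem]
              obtain ⟨i, hi⟩ := Set.mem_iUnion.1 hx
              refine Set.mem_iUnion₂.2 ⟨i, ?_, hi⟩
              by_contra hni
              exact hxs (Set.mem_iUnion₂.2 ⟨i, hs (Finset.mem_range.2 (not_le.1 hni)), hi⟩)
          · have hxs : x ∉ ⋃ i ∈ s, A i := fun h =>
              hx (Set.iUnion₂_subset_iUnion _ _ h)
            rw [Set.indicator_of_notMem hx, Set.indicator_of_notMem hxs, sub_self, norm_zero]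
            exact norm_nonneg _
        exact (hsum.mapL φ).mapL RCLike.reCLM }
  have hν : ∀ A, MeasurableSet A → ν A = RCLike.re (φ (v A)) := fun A hA => if_pos hA
  have hac : ν ≪ᵥ μ.toENNRealVectorMeasure := by
    refine VectorMeasure.AbsolutelyContinuous.mk fun A hA h0 => ?_
    rw [Measure.toENNRealVectorMeasure_apply_measurable hA] at h0
    rw [hν A hA, hv0 A h0 hA, map_zero, map_zero]
  refine ⟨ν.rnDeriv μ, ν.measurable_rnDeriv μ, ν.integrable_rnDeriv μ, fun A hA e he => ?_⟩
  have h1 : e = v A := ext_ae (by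
    filter_upwards [he, hv A hA] with x h1 h2
    rw [h1, h2])
  rw [h1, ← hν A hA, ← withDensityᵥ_apply (ν.integrable_rnDeriv μ) hA,
    SignedMeasure.withDensityᵥ_rnDeriv_eq ν μ hac]

/-- Where the density `ρ` of `A ↦ Re φ (w 1_A)` is nonnegative, `Re φ (w u) = ∫ u ρ` for every
nonnegative `u` with `w u ∈ N`: this passes from indicators to simple functions by linearity, and to
increasing limits by order-continuity on the left and monotone convergence on the right. -/
theorem IsOrderContinuous.lintegral_density (hO : N.IsOrderContinuous)
    (hN : N.HasIdealProperty) {w : N.carrier} {ω : Ω → ℝ} (hω : Measurable ω)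
    (hω0 : ∀ x, 0 < ω x) (hw : ∀ᵐ x ∂μ, (w : Ω →ₘ[μ] 𝕜) x = (ω x : 𝕜))
    (φ : StrongDual 𝕜 N.carrier) {ρ : Ω → ℝ} (hρm : Measurable ρ) (hρi : Integrable ρ μ)
    (hρ : ∀ A, MeasurableSet A → ∀ e : N.carrier,
      (∀ᵐ x ∂μ, (e : Ω →ₘ[μ] 𝕜) x = A.indicator (fun x => (ω x : 𝕜)) x) →
      RCLike.re (φ e) = ∫ x in A, ρ x ∂μ)
    {B : Set Ω} (hB : MeasurableSet B) (hB0 : ∀ x ∈ B, 0 ≤ ρ x)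
    {u : Ω → ENNReal} (hu : Measurable u) :
    (∀ x, u x ≠ ⊤) → ∀ e : N.carrier,
      (∀ᵐ x ∂μ, (e : Ω →ₘ[μ] 𝕜) x = B.indicator (fun x => ((ω x * (u x).toReal : ℝ) : 𝕜)) x) →
      0 ≤ RCLike.re (φ e) ∧
        ∫⁻ x in B, u x * ENNReal.ofReal (ρ x) ∂μ = ENNReal.ofReal (RCLike.re (φ e)) := by
  -- truncations of a product `w u` by a smaller factor remain in `N`
  have key : ∀ (u v : Ω → ENNReal), Measurable v → (∀ x, v x ≤ u x) → (∀ x, u x ≠ ⊤) →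
      ∀ e : N.carrier, (∀ᵐ x ∂μ, (e : Ω →ₘ[μ] 𝕜) x
        = B.indicator (fun x => ((ω x * (u x).toReal : ℝ) : 𝕜)) x) →
      ∃ e' : N.carrier, ∀ᵐ x ∂μ, (e' : Ω →ₘ[μ] 𝕜) x
        = B.indicator (fun x => ((ω x * (v x).toReal : ℝ) : 𝕜)) x := by
    intro u v hv hvu hut e he
    obtain ⟨e', -, he'⟩ := hN.exists_of_norm_le e
      (u := B.indicator fun x => ((ω x * (v x).toReal : ℝ) : 𝕜))
      ((RCLike.measurable_ofReal.comp (hω.mul hv.ennreal_toReal)).indicator hB).aestronglyMeasurable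
      (by
        filter_upwards [he] with x hx
        rw [hx]
        by_cases hxB : x ∉ B
        · simp [hxB]
        rw [Set.indicator_of_mem (not_not.1 hxB), Set.indicator_of_mem (not_not.1 hxB)]
        have := ENNReal.toReal_mono (hut x) (hvu x)
        have := (hω0 x).le
        rw [RCLike.norm_ofReal, RCLike.norm_ofReal, abs_of_nonneg (by positivity),
          abs_of_nonneg (by positivity)]
        gcongr)
    exact ⟨e', he'⟩
  refine Measurable.ennreal_induction ?_ ?_ ?_ hu
  · intro c s hs hut e he
    -- the value `⊤` is excluded unless `s` is empty
    have hc : s.indicator (fun _ => c) = s.indicator (fun _ => ENNReal.ofReal c.toReal) := by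
      rcases s.eq_empty_or_nonempty with rfl | ⟨x, hx⟩
      · simp
      · have := hut x
        rw [Set.indicator_of_mem hx] at this
        rw [ENNReal.ofReal_toReal this]
    obtain ⟨v, hv⟩ := hN.exists_indicator hω hw (hs.inter hB)
    have hev : e = (c.toReal : 𝕜) • v := ext_ae (by
      filter_upwards [he, hv, coe_smul_ae (c.toReal : 𝕜) v] with x h1 h2 h3
      rw [h1, h3, h2, hc]
      by_cases hxs : x ∈ s <;> by_cases hxB : x ∈ B <;> simp [hxs, hxB, mul_comm])
    have h0 : ∀ᵐ x ∂μ.restrict (s ∩ B), 0 ≤ ρ x :=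
      (ae_restrict_iff' (hs.inter hB)).2 (Eventually.of_forall fun x hx => hB0 x hx.2)
    have h1 : RCLike.re (φ e) = c.toReal * ∫ x in s ∩ B, ρ x ∂μ := by
      rw [hev, map_smul, smul_eq_mul, RCLike.re_ofReal_mul, hρ _ (hs.inter hB) v hv]
    have h2 : 0 ≤ ∫ x in s ∩ B, ρ x ∂μ := integral_nonneg_of_ae h0
    refine ⟨by rw [h1]; positivity, ?_⟩
    rw [h1, ENNReal.ofReal_mul ENNReal.toReal_nonneg,
      ofReal_integral_eq_lintegral_ofReal hρi.integrableOn h0, hc,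
      ← lintegral_const_mul _ hρm.ennreal_ofReal, ← Measure.restrict_restrict hs,
      ← lintegral_indicator hs]
    refine lintegral_congr fun x => ?_
    by_cases hxs : x ∈ s <;> simp [hxs]
  · intro f g _ hf hg ihf ihg hut e he
    have hft : ∀ x, f x ≠ ⊤ := fun x => (ENNReal.add_ne_top.1 (hut x)).1
    have hgt : ∀ x, g x ≠ ⊤ := fun x => (ENNReal.add_ne_top.1 (hut x)).2
    obtain ⟨e₁, he₁⟩ := key (f + g) f hf (fun x => le_self_add) hut e he
    obtain ⟨e₂, he₂⟩ := key (f + g) g hg (fun x => le_add_self) hut e he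
    have hee : e = e₁ + e₂ := ext_ae (by
      filter_upwards [he, he₁, he₂, coe_add_ae e₁ e₂] with x h1 h2 h3 h4
      rw [h1, h4, h2, h3]
      by_cases hxB : x ∈ B
      · simp only [Set.indicator_of_mem hxB, Pi.add_apply, ENNReal.toReal_add (hft x) (hgt x),
          mul_add, RCLike.ofReal_add]
      · simp [hxB])
    obtain ⟨h1, h2⟩ := ihf hft e₁ he₁
    obtain ⟨h3, h4⟩ := ihg hgt e₂ he₂
    rw [hee, map_add, map_add]
    refine ⟨add_nonneg h1 h3, ?_⟩
    simp only [Pi.add_apply, add_mul]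
    rw [ENNReal.ofReal_add h1 h3, ← h2, ← h4]
    exact lintegral_add_left (hf.mul hρm.ennreal_ofReal) _
  · intro f hf hmono ih hut e he
    have hle : ∀ n x, f n x ≤ ⨆ n, f n x := fun n x => le_iSup (fun n => f n x) n
    have hft : ∀ n x, f n x ≠ ⊤ := fun n x => ne_top_of_le_ne_top (hut x) (hle n x)
    choose E hE using fun n => key _ (f n) (hf n) (hle n) hut e he
    have hE' := ae_all_iff.2 hE
    have hlim : ∀ x, Tendsto (fun n => f n x) atTop (𝓝 (⨆ n, f n x)) := fun x =>
      tendsto_atTop_iSup fun m n hmn => hmono hmn x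
    have hEe : Tendsto E atTop (𝓝 e) := by
      refine hO.tendsto_of_monotone ?_ ?_
      · filter_upwards [hE'] with x hx m n hmn
        dsimp only
        rw [hx, hx]
        refine Set.indicator_rel_indicator le_rfl fun _ => ?_
        rw [RCLike.ofReal_le_ofReal]
        have := ENNReal.toReal_mono (hft n x) (hmono hmn x)
        have := (hω0 x).le
        gcongr
      · filter_upwards [hE', he] with x hx hx'
        simp only [hx, hx']
        by_cases hxB : x ∈ B
        · simp only [Set.indicator_of_mem hxB]
          refine (RCLike.continuous_ofReal.tendsto _).comp (Tendsto.const_mul _ ?_)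
          exact (ENNReal.tendsto_toReal (hut x)).comp (hlim x)
        · simp [hxB]
    have hre : Tendsto (fun n => RCLike.re (φ (E n))) atTop (𝓝 (RCLike.re (φ e))) :=
      (RCLike.continuous_re.tendsto _).comp ((φ.continuous.tendsto _).comp hEe)
    refine ⟨ge_of_tendsto' hre fun n => (ih n (hft n) (E n) (hE n)).1, ?_⟩
    refine tendsto_nhds_unique (lintegral_tendsto_of_tendsto_of_monotone
      (f := fun n x => f n x * ENNReal.ofReal (ρ x))
      (fun n => ((hf n).mul hρm.ennreal_ofReal).aemeasurable)
      (Eventually.of_forall fun x m n hmn => ?_) (Eventually.of_forall fun x => ?_)) ?_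
    · exact mul_le_mul_left (hmono hmn x) _
    · exact ENNReal.Tendsto.mul_const (hlim x) (Or.inr ENNReal.ofReal_ne_top)
    · simp only [fun n => (ih n (hft n) (E n) (hE n)).2]
      exact ENNReal.tendsto_ofReal hre

/-- The form of `lintegral_density` for `e = r 1_B ∈ N` with `r ≥ 0`, where `u = r / ω`. -/
theorem IsOrderContinuous.integrableOn_density (hO : N.IsOrderContinuous)
    (hN : N.HasIdealProperty) {w : N.carrier} {ω : Ω → ℝ} (hω : Measurable ω)
    (hω0 : ∀ x, 0 < ω x) (hw : ∀ᵐ x ∂μ, (w : Ω →ₘ[μ] 𝕜) x = (ω x : 𝕜))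
    (φ : StrongDual 𝕜 N.carrier) {ρ : Ω → ℝ} (hρm : Measurable ρ) (hρi : Integrable ρ μ)
    (hρ : ∀ A, MeasurableSet A → ∀ e : N.carrier,
      (∀ᵐ x ∂μ, (e : Ω →ₘ[μ] 𝕜) x = A.indicator (fun x => (ω x : 𝕜)) x) →
      RCLike.re (φ e) = ∫ x in A, ρ x ∂μ)
    {B : Set Ω} (hB : MeasurableSet B) (hB0 : ∀ x ∈ B, 0 ≤ ρ x)
    {r : Ω → ℝ} (hr : Measurable r) (hr0 : ∀ x, 0 ≤ r x) (e : N.carrier)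
    (he : ∀ᵐ x ∂μ, (e : Ω →ₘ[μ] 𝕜) x = B.indicator (fun x => (r x : 𝕜)) x) :
    IntegrableOn (fun x => r x * (ρ x / ω x)) B μ ∧
      RCLike.re (φ e) = ∫ x in B, r x * (ρ x / ω x) ∂μ := by
  obtain ⟨h1, h2⟩ := hO.lintegral_density hN hω hω0 hw φ hρm hρi hρ hB hB0
    (u := fun x => ENNReal.ofReal (r x / ω x)) (hr.div hω).ennreal_ofReal
    (fun x => ENNReal.ofReal_ne_top) e (by
      filter_upwards [he] with x hx
      rw [hx]
      refine congrArg (fun f => B.indicator f x) (funext fun y => ?_)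
      rw [ENNReal.toReal_ofReal (div_nonneg (hr0 y) (hω0 y).le), mul_div_cancel₀ _ (hω0 y).ne'])
  have hm : Measurable fun x => r x * (ρ x / ω x) := hr.mul (hρm.div hω)
  have h3 : ∫⁻ x in B, ENNReal.ofReal (r x * (ρ x / ω x)) ∂μ
      = ENNReal.ofReal (RCLike.re (φ e)) := by
    rw [← h2]
    refine lintegral_congr fun x => ?_
    rw [← ENNReal.ofReal_mul (div_nonneg (hr0 x) (hω0 x).le)]
    congr 1
    ring
  have h0 : ∀ᵐ x ∂μ.restrict B, 0 ≤ r x * (ρ x / ω x) :=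
    (ae_restrict_iff' hB).2 (Eventually.of_forall fun x hx =>
      mul_nonneg (hr0 x) (div_nonneg (hB0 x hx) (hω0 x).le))
  refine ⟨⟨hm.aestronglyMeasurable, ?_⟩, ?_⟩
  · rw [hasFiniteIntegral_iff_ofReal h0, h3]
    exact ENNReal.ofReal_lt_top
  · rw [integral_eq_lintegral_of_nonneg_ae h0 hm.aestronglyMeasurable, h3,
      ENNReal.toReal_ofReal h1]

/-- The real part of a functional is integration against a real function on the nonnegative elements
of `N`; the sets where the density is nonnegative and negative are treated separately. -/
theorem IsOrderContinuous.exists_re_repr [SigmaFinite μ] (hO : N.IsOrderContinuous)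
    (hN : N.HasIdealProperty) {w : N.carrier} {ω : Ω → ℝ} (hω : Measurable ω)
    (hω0 : ∀ x, 0 < ω x) (hw : ∀ᵐ x ∂μ, (w : Ω →ₘ[μ] 𝕜) x = (ω x : 𝕜))
    (φ : StrongDual 𝕜 N.carrier) :
    ∃ γ : Ω → ℝ, Measurable γ ∧ ∀ (r : Ω → ℝ), Measurable r → (∀ x, 0 ≤ r x) →
      ∀ e : N.carrier, (∀ᵐ x ∂μ, (e : Ω →ₘ[μ] 𝕜) x = (r x : 𝕜)) →
      Integrable (fun x => r x * γ x) μ ∧ RCLike.re (φ e) = ∫ x, r x * γ x ∂μ := by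
  obtain ⟨ρ, hρm, hρi, hρ⟩ := hO.exists_density hN hω hω0 hw φ
  refine ⟨fun x => ρ x / ω x, hρm.div hω, fun r hr hr0 e he => ?_⟩
  set B : Set Ω := {x | 0 ≤ ρ x} with hBdef
  have hB : MeasurableSet B := measurableSet_le measurable_const hρm
  have hex : ∀ A, MeasurableSet A → ∃ v : N.carrier, ∀ᵐ x ∂μ, (v : Ω →ₘ[μ] 𝕜) x
      = A.indicator (fun x => (r x : 𝕜)) x := fun A hA => hN.exists_indicator hr he hA
  obtain ⟨e₁, he₁⟩ := hex B hB
  obtain ⟨e₂, he₂⟩ := hex Bᶜ hB.compl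
  have hee : e = e₁ + e₂ := ext_ae (by
    filter_upwards [he, he₁, he₂, coe_add_ae e₁ e₂] with x h1 h2 h3 h4
    rw [h4, h2, h3, h1]
    exact (congrFun (Set.indicator_self_add_compl B fun x => (r x : 𝕜)) x).symm)
  obtain ⟨h1, h2⟩ := hO.integrableOn_density hN hω hω0 hw φ hρm hρi hρ hB (fun x hx => hx) hr hr0
    e₁ he₁
  obtain ⟨h3, h4⟩ := hO.integrableOn_density hN hω hω0 hw (-φ) (ρ := fun x => -ρ x) hρm.neg hρi.neg
    (fun A hA v hv => by
      rw [integral_neg, ← hρ A hA v hv, neg_apply, map_neg])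
    hB.compl (fun x hx => by
      have : ρ x < 0 := not_le.1 hx
      linarith) hr hr0 e₂ he₂
  simp only [neg_div, mul_neg] at h3 h4
  have h5 : IntegrableOn (fun x => r x * (ρ x / ω x)) Bᶜ μ := by simpa using h3.neg
  rw [integral_neg, neg_apply, map_neg, neg_inj] at h4
  have hint : Integrable (fun x => r x * (ρ x / ω x)) μ := by
    rw [← integrableOn_univ, ← Set.union_compl_self B]
    exact h1.union h5
  exact ⟨hint, by rw [hee, map_add, map_add, h2, h4, integral_add_compl hB hint]⟩

/-- Every bounded functional on an order-continuous space with the ideal property and a weak unit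
is integration against a measurable function. -/
theorem IsOrderContinuous.exists_integral_repr [SigmaFinite μ] (hO : N.IsOrderContinuous)
    (hN : N.HasIdealProperty) {w : N.carrier} {ω : Ω → ℝ} (hω : Measurable ω)
    (hω0 : ∀ x, 0 < ω x) (hw : ∀ᵐ x ∂μ, (w : Ω →ₘ[μ] 𝕜) x = (ω x : 𝕜))
    (φ : StrongDual 𝕜 N.carrier) :
    ∃ g : Ω →ₘ[μ] 𝕜, ∀ f : N.carrier,
      Integrable (fun x => (f : Ω →ₘ[μ] 𝕜) x * g x) μ ∧
        φ f = ∫ x, (f : Ω →ₘ[μ] 𝕜) x * g x ∂μ := by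
  obtain ⟨γ₁, hγ₁, h₁⟩ := hO.exists_re_repr hN hω hω0 hw φ
  -- `Im φ = Re (-i φ)`; over `ℝ` this functional is zero
  obtain ⟨γ₂, hγ₂, h₂⟩ := hO.exists_re_repr hN hω hω0 hw ((-RCLike.I : 𝕜) • φ)
  have hm : Measurable fun x => (γ₁ x : 𝕜) + RCLike.I * (γ₂ x : 𝕜) :=
    (RCLike.measurable_ofReal.comp hγ₁).add ((RCLike.measurable_ofReal.comp hγ₂).const_mul _)
  have hg := AEEqFun.coeFn_mk (μ := μ) _ hm.aestronglyMeasurable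
  set g : Ω →ₘ[μ] 𝕜 := AEEqFun.mk _ hm.aestronglyMeasurable
  let G : N.carrier → Prop := fun f => Integrable (fun x => (f : Ω →ₘ[μ] 𝕜) x * g x) μ ∧
    φ f = ∫ x, (f : Ω →ₘ[μ] 𝕜) x * g x ∂μ
  have hadd : ∀ f₁ f₂, G f₁ → G f₂ → G (f₁ + f₂) := by
    rintro f₁ f₂ ⟨a1, a2⟩ ⟨b1, b2⟩
    have hae : (fun x => (f₁ : Ω →ₘ[μ] 𝕜) x * g x + (f₂ : Ω →ₘ[μ] 𝕜) x * g x)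
        =ᵐ[μ] fun x => ((f₁ + f₂ : N.carrier) : Ω →ₘ[μ] 𝕜) x * g x := by
      filter_upwards [coe_add_ae f₁ f₂] with x hx
      rw [hx, add_mul]
    exact ⟨(a1.add b1).congr hae, by rw [map_add, a2, b2, ← integral_add a1 b1,
      integral_congr_ae hae]⟩
  have hsmul : ∀ (c : 𝕜) f, G f → G (c • f) := by
    rintro c f ⟨a1, a2⟩
    have hae : (fun x => c * ((f : Ω →ₘ[μ] 𝕜) x * g x))
        =ᵐ[μ] fun x => ((c • f : N.carrier) : Ω →ₘ[μ] 𝕜) x * g x := by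
      filter_upwards [coe_smul_ae c f] with x hx
      rw [hx, mul_assoc]
    exact ⟨(a1.const_mul c).congr hae, by rw [map_smul, a2, smul_eq_mul, ← integral_const_mul,
      integral_congr_ae hae]⟩
  have hpos : ∀ r : Ω → ℝ, Measurable r → (∀ x, 0 ≤ r x) → ∀ e : N.carrier,
      (∀ᵐ x ∂μ, (e : Ω →ₘ[μ] 𝕜) x = (r x : 𝕜)) → G e := by
    intro r hr hr0 e he
    obtain ⟨i1, e1⟩ := h₁ r hr hr0 e he
    obtain ⟨i2, e2⟩ := h₂ r hr hr0 e he
    have i1' : Integrable (fun x => ((r x * γ₁ x : ℝ) : 𝕜)) μ := i1.ofReal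
    have i2' : Integrable (fun x => RCLike.I * ((r x * γ₂ x : ℝ) : 𝕜)) μ := i2.ofReal.const_mul _
    have hae : (fun x => ((r x * γ₁ x : ℝ) : 𝕜) + RCLike.I * ((r x * γ₂ x : ℝ) : 𝕜))
        =ᵐ[μ] fun x => (e : Ω →ₘ[μ] 𝕜) x * g x := by
      filter_upwards [he, hg] with x h1 h2
      rw [h1, h2]
      push_cast
      ring
    refine ⟨(i1'.add i2').congr hae, ?_⟩
    rw [← integral_congr_ae hae, integral_add i1' i2', integral_const_mul, integral_ofReal,
      integral_ofReal, ← e1, ← e2, smul_apply, smul_eq_mul, neg_mul, map_neg,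
      RCLike.I_mul_re, neg_neg, mul_comm, RCLike.re_add_im]
  refine ⟨g, fun f => ?_⟩
  have hpart : ∀ ψ : 𝕜 → ℝ, Measurable ψ → (∀ z, |ψ z| ≤ ‖z‖) →
      ∃ e : N.carrier, G e ∧ ∀ᵐ x ∂μ, (e : Ω →ₘ[μ] 𝕜) x
        = ((ψ ((f : Ω →ₘ[μ] 𝕜) x) : ℝ) : 𝕜) := by
    intro ψ hψ hle
    have hψf : Measurable fun x => ψ ((f : Ω →ₘ[μ] 𝕜) x) := hψ.comp (f : Ω →ₘ[μ] 𝕜).measurable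
    have haux : ∀ s : ℝ → ℝ, Measurable s → (∀ t, 0 ≤ s t) → (∀ t, s t ≤ |t|) →
        ∃ e : N.carrier, G e ∧ ∀ᵐ x ∂μ, (e : Ω →ₘ[μ] 𝕜) x
          = ((s (ψ ((f : Ω →ₘ[μ] 𝕜) x)) : ℝ) : 𝕜) := by
      intro s hs hs0 hs1
      obtain ⟨e, -, he⟩ := hN.exists_of_norm_le f
        (u := fun x => ((s (ψ ((f : Ω →ₘ[μ] 𝕜) x)) : ℝ) : 𝕜))
        (RCLike.measurable_ofReal.comp (hs.comp hψf)).aestronglyMeasurable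
        (Eventually.of_forall fun x => by
          rw [RCLike.norm_ofReal, abs_of_nonneg (hs0 _)]
          exact (hs1 _).trans (hle _))
      exact ⟨e, hpos _ (hs.comp hψf) (fun x => hs0 _) e he, he⟩
    obtain ⟨p, hp, hp'⟩ := haux (fun t => max t 0) (by fun_prop) (fun t => le_max_right _ _)
      fun t => max_le (le_abs_self t) (abs_nonneg t)
    obtain ⟨q, hq, hq'⟩ := haux (fun t => max (-t) 0) (by fun_prop) (fun t => le_max_right _ _)
      fun t => max_le (neg_le_abs t) (abs_nonneg t)
    refine ⟨p + (-1 : 𝕜) • q, hadd _ _ hp (hsmul _ _ hq), ?_⟩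
    filter_upwards [hp', hq', coe_add_ae p ((-1 : 𝕜) • q), coe_smul_ae (-1 : 𝕜) q]
      with x h1 h2 h3 h4
    rw [h3, h4, h1, h2, neg_one_mul, ← RCLike.ofReal_neg, ← RCLike.ofReal_add, ← sub_eq_add_neg,
      max_zero_sub_max_neg_zero_eq_self]
  obtain ⟨a, ha, ha'⟩ := hpart RCLike.re RCLike.measurable_re RCLike.abs_re_le_norm
  obtain ⟨b, hb, hb'⟩ := hpart RCLike.im RCLike.measurable_im RCLike.abs_im_le_norm
  have hf : f = a + (RCLike.I : 𝕜) • b := ext_ae (by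
    filter_upwards [ha', hb', coe_add_ae a ((RCLike.I : 𝕜) • b), coe_smul_ae (RCLike.I : 𝕜) b]
      with x h1 h2 h3 h4
    rw [h3, h4, h1, h2, mul_comm, RCLike.re_add_im])
  rw [hf]
  exact hadd _ _ ha (hsmul _ _ hb)

end NormedFunctionSpace

/-! ### The Köthe dual as the dual space -/

namespace NormedFunctionSpace

variable {𝕜 : Type*} [RCLike 𝕜] {Ω : Type*} [MeasurableSpace Ω] {μ : Measure Ω}
  {N : NormedFunctionSpace 𝕜 μ}

/-- The phase of `f` can be changed, without increasing the norm, so that `f g` becomes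
`|f| |g|`. -/
theorem HasIdealProperty.exists_mul_eq_norm (hN : N.HasIdealProperty) (f : N.carrier)
    (g : Ω →ₘ[μ] 𝕜) : ∃ f' : N.carrier, ‖f'‖ ≤ ‖f‖ ∧ ∀ᵐ x ∂μ,
      (f' : Ω →ₘ[μ] 𝕜) x * g x = ((‖(f : Ω →ₘ[μ] 𝕜) x * g x‖ : ℝ) : 𝕜) := by
  have hg := g.measurable
  have hf := (f : Ω →ₘ[μ] 𝕜).measurable
  obtain ⟨v, hv, hv'⟩ := hN.exists_of_norm_le f
    (u := fun x => ((‖(f : Ω →ₘ[μ] 𝕜) x‖ : ℝ) : 𝕜) *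
      (((‖g x‖⁻¹ : ℝ) : 𝕜) * (starRingEnd 𝕜) (g x)))
    ((RCLike.measurable_ofReal.comp hf.norm).mul
      ((RCLike.measurable_ofReal.comp hg.norm.inv).mul
        (RCLike.continuous_conj.measurable.comp hg))).aestronglyMeasurable
    (Eventually.of_forall fun x => by
      rw [norm_mul, norm_mul, RCLike.norm_ofReal, RCLike.norm_ofReal, RCLike.norm_conj, abs_norm,
        abs_of_nonneg (inv_nonneg.2 (norm_nonneg _))]
      exact mul_le_of_le_one_right (norm_nonneg _) inv_mul_le_one)
  refine ⟨v, hv, ?_⟩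
  filter_upwards [hv'] with x hx
  rw [hx, mul_assoc, mul_assoc, RCLike.conj_mul, norm_mul]
  by_cases h0 : g x = 0
  · simp [h0]
  · have : ‖g x‖ ≠ 0 := norm_ne_zero_iff.2 h0
    norm_cast
    field_simp

end NormedFunctionSpace

namespace BanachFunctionSpace

variable {𝕜 : Type*} [RCLike 𝕜] {Ω : Type*} [MeasurableSpace Ω] {μ : Measure Ω}

open NormedFunctionSpace

/-- Hölder's inequality for the Köthe dual. -/
theorem integral_norm_mul_le (X : BanachFunctionSpace 𝕜 μ) (g : X.kotheDual.carrier)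
    (f : X.carrier) :
    ∫ x, ‖(f : Ω →ₘ[μ] 𝕜) x * (g : Ω →ₘ[μ] 𝕜) x‖ ∂μ ≤ ‖g‖ * ‖f‖ := by
  rcases eq_or_ne f 0 with rfl | hf
  · rw [norm_zero, mul_zero]
    refine le_of_eq (integral_eq_zero_of_ae ?_)
    filter_upwards [coe_zero_ae (N := X.toNormedFunctionSpace)] with x hx
    rw [hx, zero_mul, norm_zero]
    rfl
  · have hn := norm_pos_iff.2 hf
    have h1 : ‖((‖f‖⁻¹ : ℝ) : 𝕜) • f‖ = 1 := by
      rw [norm_smul, RCLike.norm_ofReal, abs_of_pos (inv_pos.2 hn), inv_mul_cancel₀ hn.ne']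
    have h2 : ∫ x, ‖((((‖f‖⁻¹ : ℝ) : 𝕜) • f : X.carrier) : Ω →ₘ[μ] 𝕜) x *
        (g : Ω →ₘ[μ] 𝕜) x‖ ∂μ ≤ ‖g‖ := X.integral_le_kotheNorm g _ h1
    have h3 : ∫ x, ‖((((‖f‖⁻¹ : ℝ) : 𝕜) • f : X.carrier) : Ω →ₘ[μ] 𝕜) x *
        (g : Ω →ₘ[μ] 𝕜) x‖ ∂μ
        = ‖f‖⁻¹ * ∫ x, ‖(f : Ω →ₘ[μ] 𝕜) x * (g : Ω →ₘ[μ] 𝕜) x‖ ∂μ := by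
      rw [← integral_const_mul]
      refine integral_congr_ae ?_
      filter_upwards [coe_smul_ae ((‖f‖⁻¹ : ℝ) : 𝕜) f] with x hx
      rw [hx, mul_assoc, norm_mul _ (_ * _), RCLike.norm_ofReal, abs_of_pos (inv_pos.2 hn)]
    rw [h3, inv_mul_le_iff₀ hn] at h2
    linarith

theorem kotheDual_ideal (X : BanachFunctionSpace 𝕜 μ) : X.kotheDual.HasIdealProperty := by
  intro g h hle
  have hint : ∀ f ∈ X.carrier, Integrable (fun x => f x * h x) μ := by
    intro f hf
    refine (g.2 f hf).mono (f.aestronglyMeasurable.mul h.aestronglyMeasurable) ?_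
    filter_upwards [hle] with x hx
    rw [norm_mul, norm_mul]
    gcongr
  refine ⟨hint, Real.sSup_le ?_ (norm_nonneg g)⟩
  rintro r ⟨f, hf, rfl⟩
  have h1 := X.integral_norm_mul_le g f
  rw [hf, mul_one] at h1
  refine le_trans (integral_mono_ae (hint _ f.2).norm (g.2 _ f.2).norm ?_) h1
  filter_upwards [hle] with x hx
  rw [norm_mul, norm_mul]
  gcongr

/-- Integration against an element `g` of the Köthe dual `X'`, as a bounded functional on `X`. -/
def kotheFunctional (X : BanachFunctionSpace 𝕜 μ) (g : X.kotheDual.carrier) :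
    StrongDual 𝕜 X.carrier :=
  LinearMap.mkContinuous
    { toFun := fun f => ∫ x, (f : Ω →ₘ[μ] 𝕜) x * (g : Ω →ₘ[μ] 𝕜) x ∂μ
      map_add' := fun f₁ f₂ => by
        rw [← integral_add (g.2 _ f₁.2) (g.2 _ f₂.2)]
        refine integral_congr_ae ?_
        filter_upwards [coe_add_ae f₁ f₂] with x hx
        rw [hx, add_mul]
      map_smul' := fun c f => by
        rw [RingHom.id_apply, smul_eq_mul, ← integral_const_mul]
        refine integral_congr_ae ?_
        filter_upwards [coe_smul_ae c f] with x hx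
        rw [hx, mul_assoc] } ‖g‖
    fun f => (norm_integral_le_integral_norm _).trans (X.integral_norm_mul_le g f)

/-- The isometric embedding of the Köthe dual `X'` into the dual of `X`, which sends `g` to
integration against `g`. -/
def kotheToDual (X : BanachFunctionSpace 𝕜 μ) :
    X.kotheDual.carrier →ₗᵢ[𝕜] StrongDual 𝕜 X.carrier where
  toFun := X.kotheFunctional
  map_add' g₁ g₂ := by
    ext f
    refine (integral_congr_ae ?_).trans (integral_add (g₁.2 _ f.2) (g₂.2 _ f.2))
    filter_upwards [coe_add_ae g₁ g₂] with x hx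
    rw [hx, mul_add]
  map_smul' c g := by
    ext f
    refine (integral_congr_ae ?_).trans (integral_const_mul c _)
    filter_upwards [coe_smul_ae c g] with x hx
    rw [hx]
    ring
  norm_map' g := by
    change ‖X.kotheFunctional g‖ = ‖g‖
    refine le_antisymm (ContinuousLinearMap.opNorm_le_bound _ (norm_nonneg _) fun f =>
      (norm_integral_le_integral_norm _).trans (X.integral_norm_mul_le g f)) ?_
    refine Real.sSup_le ?_ (norm_nonneg _)
    rintro r ⟨f, hf, rfl⟩
    obtain ⟨f', hf', h⟩ := X.ideal.exists_mul_eq_norm f g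
    have h1 : X.kotheFunctional g f' =
        ((∫ x, ‖(f : Ω →ₘ[μ] 𝕜) x * (g : Ω →ₘ[μ] 𝕜) x‖ ∂μ : ℝ) : 𝕜) := by
      rw [← integral_ofReal]
      exact integral_congr_ae h
    have h2 := (X.kotheFunctional g).le_opNorm f'
    rw [h1, RCLike.norm_ofReal, abs_of_nonneg (integral_nonneg fun x => norm_nonneg _)] at h2
    refine h2.trans ?_
    rw [hf] at hf'
    exact mul_le_of_le_one_right (norm_nonneg _) hf'

theorem kotheToDual_apply (X : BanachFunctionSpace 𝕜 μ) (g : X.kotheDual.carrier) (f : X.carrier) :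
    X.kotheToDual g f = ∫ x, (f : Ω →ₘ[μ] 𝕜) x * (g : Ω →ₘ[μ] 𝕜) x ∂μ := rfl

/-- If `X` is order-continuous, then its dual is its Köthe dual. -/
theorem kotheToDual_surjective [SigmaFinite μ] (X : BanachFunctionSpace 𝕜 μ)
    (hO : X.IsOrderContinuous) : Function.Surjective X.kotheToDual := by
  intro φ
  obtain ⟨w, ω, hω, hω0, hw⟩ := X.exists_weak_unit
  obtain ⟨g, hg⟩ := hO.exists_integral_repr X.ideal hω hω0 hw φ
  refine ⟨⟨g, fun f hf => (hg ⟨f, hf⟩).1⟩, ?_⟩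
  ext f
  exact (hg f).2.symm

/-- The identification of the Köthe dual of an order-continuous `X` with the dual of `X`. -/
def kotheEquivDual [SigmaFinite μ] (X : BanachFunctionSpace 𝕜 μ) (hO : X.IsOrderContinuous) :
    X.kotheDual.carrier ≃ₗᵢ[𝕜] StrongDual 𝕜 X.carrier :=
  LinearIsometryEquiv.ofSurjective X.kotheToDual (X.kotheToDual_surjective hO)

theorem kotheEquivDual_apply [SigmaFinite μ] (X : BanachFunctionSpace 𝕜 μ)
    (hO : X.IsOrderContinuous) (g : X.kotheDual.carrier) (f : X.carrier) :
    X.kotheEquivDual hO g f = ∫ x, (f : Ω →ₘ[μ] 𝕜) x * (g : Ω →ₘ[μ] 𝕜) x ∂μ := rfl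

theorem kotheDual_isComplete [SigmaFinite μ] (X : BanachFunctionSpace 𝕜 μ)
    (hO : X.IsOrderContinuous) : X.kotheDual.IsComplete :=
  (X.kotheEquivDual hO).toIsometryEquiv.completeSpace

/-- Saturation of the Köthe dual: a functional that does not vanish at an indicator `1_F ∈ X` is
integration against some `g ∈ X'`, and `|g|` is bounded below on a subset of `F` of positive
measure. -/
theorem kotheDual_saturated [SigmaFinite μ] (X : BanachFunctionSpace 𝕜 μ)
    (hO : X.IsOrderContinuous) : X.kotheDual.HasSaturationProperty := by
  intro E hE hE0
  obtain ⟨F, hFE, hF, hF0, f, hfX, hfF⟩ := X.saturated E hE hE0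
  have hfne : (⟨f, hfX⟩ : X.carrier) ≠ 0 := by
    intro h0
    refine hF0.ne' (measure_eq_zero_iff_ae_notMem.2 ?_)
    filter_upwards [hfF, coe_zero_ae (N := X.toNormedFunctionSpace)] with x h1 h2 hxF
    rw [← h0, h1, Set.indicator_of_mem hxF] at h2
    exact one_ne_zero h2
  obtain ⟨φ, -, hφ⟩ := exists_dual_vector 𝕜 (⟨f, hfX⟩ : X.carrier) (norm_ne_zero_iff.2 hfne)
  obtain ⟨g, rfl⟩ := X.kotheToDual_surjective hO φ
  set G : ℕ → Set Ω := fun n => F ∩ {x | 1 ≤ (n + 1 : ℝ) * ‖(g : Ω →ₘ[μ] 𝕜) x‖} with hG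
  have hGm : ∀ n, MeasurableSet (G n) := fun n =>
    hF.inter (measurableSet_le measurable_const ((g : Ω →ₘ[μ] 𝕜).measurable.norm.const_mul _))
  obtain ⟨n, hn⟩ : ∃ n, 0 < μ (G n) := by
    by_contra! hcon
    have h0 : ∀ᵐ x ∂μ, ∀ n, x ∉ G n :=
      ae_all_iff.2 fun n => measure_eq_zero_iff_ae_notMem.1 (le_antisymm (hcon n) bot_le)
    have h1 : X.kotheToDual g ⟨f, hfX⟩ = 0 := by
      rw [kotheToDual_apply]
      refine integral_eq_zero_of_ae ?_
      filter_upwards [h0, hfF] with x h1 h2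
      rw [h2]
      by_cases hxF : x ∈ F
      · by_contra hne
        have hgx : 0 < ‖(g : Ω →ₘ[μ] 𝕜) x‖ := norm_pos_iff.2 fun h => hne (by simp [h])
        obtain ⟨n, hn⟩ := exists_nat_gt (1 / ‖(g : Ω →ₘ[μ] 𝕜) x‖)
        refine h1 n ⟨hxF, ?_⟩
        rw [div_lt_iff₀ hgx] at hn
        change 1 ≤ ((n : ℝ) + 1) * ‖(g : Ω →ₘ[μ] 𝕜) x‖
        linarith
      · simp [hxF]
    rw [h1] at hφ
    exact hfne (norm_eq_zero.1 (by exact_mod_cast hφ.symm))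
  obtain ⟨v, -, hv⟩ := X.kotheDual_ideal.exists_of_norm_le (((n + 1 : ℝ) : 𝕜) • g)
    (u := (G n).indicator fun _ => (1 : 𝕜))
    (measurable_const.indicator (hGm n)).aestronglyMeasurable (by
      filter_upwards [coe_smul_ae ((n + 1 : ℝ) : 𝕜) g] with x hx
      rw [hx, norm_mul, RCLike.norm_ofReal, abs_of_nonneg (by positivity)]
      by_cases hxG : x ∈ G n
      · rw [Set.indicator_of_mem hxG, norm_one]
        exact hxG.2
      · rw [Set.indicator_of_notMem hxG, norm_zero]
        positivity)
  exact ⟨G n, Set.inter_subset_left.trans hFE, hGm n, hn, v, v.2, hv⟩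

/-- The Köthe dual of an order-continuous Banach function space, as a Banach function space. -/
def kotheBanach [SigmaFinite μ] (X : BanachFunctionSpace 𝕜 μ) (hO : X.IsOrderContinuous) :
    BanachFunctionSpace 𝕜 μ where
  toNormedFunctionSpace := X.kotheDual
  isComplete := X.kotheDual_isComplete hO
  ideal := X.kotheDual_ideal
  saturated := X.kotheDual_saturated hO

end BanachFunctionSpace

/-! ### Reflexive function spaces -/

namespace NormedFunctionSpace

variable {𝕜 : Type*} [RCLike 𝕜] {Ω : Type*} [MeasurableSpace Ω] {μ : Measure Ω}
  {N : NormedFunctionSpace 𝕜 μ}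

/-- Reflexive function spaces are order-continuous: a weak limit of a sequence `fₙ ↓ 0` is dominated
by every `fₙ`, hence vanishes. -/
theorem IsReflexive.isOrderContinuous (hR : N.IsReflexive) (hN : N.HasIdealProperty) :
    N.IsOrderContinuous := by
  intro f hf hf0
  have hle : ∀ n k, n ≤ k → ∀ᵐ x ∂μ, ‖(f k : Ω →ₘ[μ] 𝕜) x‖ ≤ ‖(f n : Ω →ₘ[μ] 𝕜) x‖ := by
    intro n k hnk
    filter_upwards [hf, hf0] with x h1 h2
    have h3 : ∀ n, 0 ≤ (f n : Ω →ₘ[μ] 𝕜) x := fun n => h1.le_of_tendsto h2 n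
    rw [RCLike.norm_eq_re_of_nonneg (h3 n), RCLike.norm_eq_re_of_nonneg (h3 k)]
    exact (RCLike.le_iff_re_im.1 (h1 hnk)).1
  obtain ⟨y, hy⟩ := exists_tendsto_weak_of_reflexive hR (f := f) fun n =>
    hN.norm_le (hle 0 n n.zero_le)
  have hy' : ∀ n, ∀ᵐ x ∂μ, ‖(y : Ω →ₘ[μ] 𝕜) x‖ ≤ ‖(f n : Ω →ₘ[μ] 𝕜) x‖ := by
    intro n
    refine mem_of_tendsto_weak (𝕜 := 𝕜) (hN.isClosed_setOf_norm_le (f n : Ω →ₘ[μ] 𝕜)) ?_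
      (l := (hyperfilter ℕ : Filter ℕ)) (x := f)
      ((hyperfilter_eventually_ge n).mono fun k hk => hle n k hk) hy
    intro a ha b hb s t hs ht hst
    filter_upwards [ha, hb, coe_add_ae ((s : 𝕜) • a) ((t : 𝕜) • b), coe_smul_ae (s : 𝕜) a,
      coe_smul_ae (t : 𝕜) b] with x h1 h2 h3 h4 h5
    rw [h3, h4, h5]
    refine (norm_add_le _ _).trans ?_
    rw [norm_mul, norm_mul, RCLike.norm_ofReal, RCLike.norm_ofReal, abs_of_nonneg hs,
      abs_of_nonneg ht]
    calc _ ≤ s * ‖(f n : Ω →ₘ[μ] 𝕜) x‖ + t * ‖(f n : Ω →ₘ[μ] 𝕜) x‖ := by gcongr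
      _ = _ := by rw [← add_mul, hst, one_mul]
  have hy0 : y = 0 := ext_ae (by
    filter_upwards [ae_all_iff.2 hy', hf0, coe_zero_ae (N := N)] with x h1 h2 h3
    rw [h3]
    exact norm_le_zero_iff.1 (ge_of_tendsto' (tendsto_zero_iff_norm_tendsto_zero.1 h2) h1))
  exact hN.tendsto_norm_of_weak hf hf0 (l := (hyperfilter ℕ : Filter ℕ)) fun φ => by
    simpa [hy0] using hy φ

/-- Reflexive function spaces have the Fatou property: a weak limit of a bounded sequence
`0 ≤ fₙ ↑ g` dominates `g`, so `g` belongs to the space, and `fₙ → g` in norm by order-continuity. -/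
theorem IsReflexive.hasFatouProperty (hR : N.IsReflexive) (hN : N.HasIdealProperty) :
    N.HasFatouProperty := by
  intro f g hf0 hf hfg hb
  obtain ⟨C, hC⟩ := hb
  obtain ⟨y, hy⟩ := exists_tendsto_weak_of_reflexive hR (f := f) fun n => hC (Set.mem_range_self n)
  have hy' : ∀ n, ∀ᵐ x ∂μ,
      RCLike.re ((f n : Ω →ₘ[μ] 𝕜) x) ≤ RCLike.re ((y : Ω →ₘ[μ] 𝕜) x) := by
    intro n
    refine mem_of_tendsto_weak (𝕜 := 𝕜) (hN.isClosed_setOf_le_re (f n : Ω →ₘ[μ] 𝕜)) ?_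
      (l := (hyperfilter ℕ : Filter ℕ)) (x := f)
      ((hyperfilter_eventually_ge n).mono fun k hk => ?_) hy
    · intro a ha b hb s t hs ht hst
      filter_upwards [ha, hb, coe_add_ae ((s : 𝕜) • a) ((t : 𝕜) • b), coe_smul_ae (s : 𝕜) a,
        coe_smul_ae (t : 𝕜) b] with x h1 h2 h3 h4 h5
      rw [h3, h4, h5, map_add, RCLike.re_ofReal_mul, RCLike.re_ofReal_mul]
      calc RCLike.re ((f n : Ω →ₘ[μ] 𝕜) x)
          = s * RCLike.re ((f n : Ω →ₘ[μ] 𝕜) x) + t * RCLike.re ((f n : Ω →ₘ[μ] 𝕜) x) := by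
            rw [← add_mul, hst, one_mul]
        _ ≤ _ := by gcongr
    · filter_upwards [hf] with x hx
      exact (RCLike.le_iff_re_im.1 (hx hk)).1
  have hle : ∀ᵐ x ∂μ, ∀ n, (f n : Ω →ₘ[μ] 𝕜) x ≤ g x := by
    filter_upwards [hf, hfg] with x h1 h2 n
    exact h1.ge_of_tendsto h2 n
  have hfn : ∀ᵐ x ∂μ, ∀ n, 0 ≤ (f n : Ω →ₘ[μ] 𝕜) x := ae_all_iff.2 hf0
  obtain ⟨hg, -⟩ := hN y g (by
    filter_upwards [hle, hfn, ae_all_iff.2 hy', hfg] with x h1 h2 h3 h4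
    rw [RCLike.norm_eq_re_of_nonneg ((h2 0).trans (h1 0))]
    exact (le_of_tendsto' ((RCLike.continuous_re.tendsto _).comp h4) h3).trans
      (RCLike.re_le_norm _))
  have hlim : Tendsto f atTop (𝓝 (⟨g, hg⟩ : N.carrier)) :=
    (hR.isOrderContinuous hN).tendsto_of_monotone hf hfg
  refine ⟨hg, ?_, fun b hb => le_of_tendsto' hlim.norm fun n => hb (Set.mem_range_self n)⟩
  rintro _ ⟨n, rfl⟩
  refine hN.norm_le ?_
  filter_upwards [hle, hfn] with x h1 h2
  rw [RCLike.norm_eq_re_of_nonneg (h2 n), RCLike.norm_eq_re_of_nonneg ((h2 n).trans (h1 n))]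
  exact (RCLike.le_iff_re_im.1 (h1 n)).1

end NormedFunctionSpace

/-! ### The Köthe dual of a reflexive space, and reflexivity from order-continuity -/

namespace BanachFunctionSpace

variable {𝕜 : Type*} [RCLike 𝕜] {Ω : Type*} [MeasurableSpace Ω] {μ : Measure Ω}

open NormedFunctionSpace

/-- If `X` is reflexive, every functional on `X' = X*` is evaluation at some `f ∈ X`, so a sequence
`gₙ ↓ 0` in `X'` tends to `0` weakly by dominated convergence. -/
theorem kotheDual_isOrderContinuous [SigmaFinite μ] (X : BanachFunctionSpace 𝕜 μ)
    (hR : X.IsReflexive) : X.kotheDual.IsOrderContinuous := by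
  have hO := hR.isOrderContinuous X.ideal
  intro g hg hg0
  refine X.kotheDual_ideal.tendsto_norm_of_weak hg hg0 (l := atTop) fun ψ => ?_
  obtain ⟨f, hf⟩ := hR (ψ.comp ((X.kotheEquivDual hO).symm : _ →L[𝕜] X.kotheDual.carrier))
  have hψ : ∀ n, ψ (g n) = ∫ x, (f : Ω →ₘ[μ] 𝕜) x * (g n : Ω →ₘ[μ] 𝕜) x ∂μ := by
    intro n
    rw [← X.kotheEquivDual_apply hO, ← NormedSpace.dual_def 𝕜 X.carrier f, hf]
    simp
  simp only [hψ]
  have h0 : ∫ x, (f : Ω →ₘ[μ] 𝕜) x * 0 ∂μ = 0 := by simp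
  rw [← h0]
  refine tendsto_integral_of_dominated_convergence
    (fun x => ‖(f : Ω →ₘ[μ] 𝕜) x * (g 0 : Ω →ₘ[μ] 𝕜) x‖)
    (fun n => ((g n).2 _ f.2).aestronglyMeasurable) ((g 0).2 _ f.2).norm (fun n => ?_) ?_
  · filter_upwards [hg, hg0] with x h1 h2
    have h3 : ∀ n, 0 ≤ (g n : Ω →ₘ[μ] 𝕜) x := fun n => h1.le_of_tendsto h2 n
    rw [norm_mul, norm_mul, RCLike.norm_eq_re_of_nonneg (h3 n), RCLike.norm_eq_re_of_nonneg (h3 0)]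
    exact mul_le_mul_of_nonneg_left (RCLike.le_iff_re_im.1 (h1 n.zero_le)).1 (norm_nonneg _)
  · filter_upwards [hg0] with x hx
    exact hx.const_mul _

/-- If `X` is order-continuous and has the Fatou property, then any `h` whose integral against `X'`
is a bounded functional belongs to `X`: the truncations `min (|h|, n w)`, for a weak unit `w` of
`X`, have norms bounded by that of the functional because `X* = X'`. -/
theorem mem_carrier_of_integral_repr [SigmaFinite μ] (X : BanachFunctionSpace 𝕜 μ)
    (hO : X.IsOrderContinuous) (hF : X.HasFatouProperty) (ψ : StrongDual 𝕜 X.kotheDual.carrier)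
    (h : Ω →ₘ[μ] 𝕜) (hh : ∀ g : X.kotheDual.carrier,
      Integrable (fun x => (g : Ω →ₘ[μ] 𝕜) x * h x) μ ∧
        ψ g = ∫ x, (g : Ω →ₘ[μ] 𝕜) x * h x ∂μ) : h ∈ X.carrier := by
  obtain ⟨w, ω, hω, hω0, hw⟩ := X.exists_weak_unit
  have hmin : ∀ n : ℕ, Measurable fun x => ((min ‖h x‖ (n * ω x) : ℝ) : 𝕜) := fun n =>
    RCLike.measurable_ofReal.comp (h.measurable.norm.min (hω.const_mul _))
  have hnn : ∀ (n : ℕ) x, 0 ≤ min ‖h x‖ (n * ω x) := fun n x =>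
    le_min (norm_nonneg _) (mul_nonneg n.cast_nonneg (hω0 x).le)
  have hex : ∀ n : ℕ, ∃ f : X.carrier, ∀ᵐ x ∂μ, (f : Ω →ₘ[μ] 𝕜) x
      = ((min ‖h x‖ (n * ω x) : ℝ) : 𝕜) := by
    intro n
    obtain ⟨f, -, hf⟩ := X.ideal.exists_of_norm_le ((n : 𝕜) • w) (hmin n).aestronglyMeasurable (by
      filter_upwards [hw, coe_smul_ae (n : 𝕜) w] with x h1 h2
      rw [h2, h1, RCLike.norm_ofReal, abs_of_nonneg (hnn n x), norm_mul, RCLike.norm_natCast,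
        RCLike.norm_ofReal, abs_of_pos (hω0 x)]
      exact min_le_right _ _)
    exact ⟨f, hf⟩
  choose f hf using hex
  have hbound : ∀ n, ‖f n‖ ≤ ‖ψ‖ := by
    intro n
    refine NormedSpace.norm_le_dual_bound 𝕜 (f n) (norm_nonneg _) fun φ => ?_
    obtain ⟨g, rfl⟩ := X.kotheToDual_surjective hO φ
    obtain ⟨g', hg', hg'h⟩ := X.kotheDual_ideal.exists_mul_eq_norm g h
    rw [LinearIsometry.norm_map]
    calc ‖X.kotheToDual g (f n)‖
        ≤ ∫ x, ‖(f n : Ω →ₘ[μ] 𝕜) x * (g : Ω →ₘ[μ] 𝕜) x‖ ∂μ := norm_integral_le_integral_norm _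
      _ ≤ ∫ x, ‖(g : Ω →ₘ[μ] 𝕜) x * h x‖ ∂μ := by
          refine integral_mono_ae (g.2 _ (f n).2).norm (hh g).1.norm ?_
          filter_upwards [hf n] with x hx
          rw [hx, norm_mul, norm_mul, RCLike.norm_ofReal, abs_of_nonneg (hnn n x), mul_comm]
          gcongr
          exact min_le_left _ _
      _ = ‖ψ g'‖ := by
          rw [(hh g').2, integral_congr_ae hg'h, integral_ofReal, RCLike.norm_ofReal,
            abs_of_nonneg (integral_nonneg fun x => norm_nonneg _)]
      _ ≤ ‖ψ‖ * ‖g‖ := (ψ.le_opNorm g').trans (by gcongr)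
  have hm : Measurable fun x => ((‖h x‖ : ℝ) : 𝕜) := RCLike.measurable_ofReal.comp h.measurable.norm
  have habs := AEEqFun.coeFn_mk (μ := μ) _ hm.aestronglyMeasurable
  obtain ⟨hmem, -⟩ := hF f (AEEqFun.mk _ hm.aestronglyMeasurable) (fun n => by
      filter_upwards [hf n] with x hx
      rw [hx]
      exact RCLike.ofReal_nonneg.2 (hnn n x)) (by
      filter_upwards [ae_all_iff.2 hf] with x hx m n hmn
      dsimp only
      rw [hx, hx, RCLike.ofReal_le_ofReal]
      have := (hω0 x).le
      gcongr) (by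
      filter_upwards [ae_all_iff.2 hf, habs] with x hx hx'
      rw [hx']
      refine tendsto_const_nhds.congr' ?_
      obtain ⟨n, hn⟩ := exists_nat_ge (‖h x‖ / ω x)
      filter_upwards [eventually_ge_atTop n] with m hm
      rw [hx, min_eq_left]
      rw [div_le_iff₀ (hω0 x)] at hn
      have h1 : (n : ℝ) ≤ m := by exact_mod_cast hm
      exact hn.trans (mul_le_mul_of_nonneg_right h1 (hω0 x).le)) ⟨‖ψ‖, by
      rintro _ ⟨n, rfl⟩
      exact hbound n⟩
  obtain ⟨hmem', -⟩ := X.ideal ⟨_, hmem⟩ h (by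
    filter_upwards [habs] with x hx
    rw [hx, RCLike.norm_ofReal, abs_norm])
  exact hmem'

/-- The Fatou property and order-continuity of `X` and `X'` give `X** = (X')* = X`. -/
theorem isReflexive_of_hasFatouProperty [SigmaFinite μ] (X : BanachFunctionSpace 𝕜 μ)
    (hF : X.HasFatouProperty) (hO : X.IsOrderContinuous) (hO' : X.kotheDual.IsOrderContinuous) :
    X.IsReflexive := by
  intro Φ
  obtain ⟨w, ω, hω, hω0, hw⟩ := (X.kotheBanach hO).exists_weak_unit
  set ψ : StrongDual 𝕜 X.kotheDual.carrier :=
    Φ.comp (X.kotheEquivDual hO : X.kotheDual.carrier →L[𝕜] StrongDual 𝕜 X.carrier)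
  obtain ⟨h, hh⟩ := hO'.exists_integral_repr X.kotheDual_ideal hω hω0 hw ψ
  have hmem := X.mem_carrier_of_integral_repr hO hF ψ h hh
  refine ⟨⟨h, hmem⟩, ?_⟩
  ext φ
  obtain ⟨g, rfl⟩ := (X.kotheEquivDual hO).surjective φ
  rw [NormedSpace.dual_def, kotheEquivDual_apply]
  refine Eq.trans ?_ (hh g).2.symm
  simp only [mul_comm]

end BanachFunctionSpace

end

theorem corollary3p13 {𝕜 : Type*} [RCLike 𝕜] {Ω : Type*} [MeasurableSpace Ω] (μ : Measure Ω)
    [SigmaFinite μ] (X : BanachFunctionSpace 𝕜 μ) :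
    X.IsReflexive ↔ X.HasFatouProperty ∧ X.IsOrderContinuous ∧ X.kotheDual.IsOrderContinuous :=
  ⟨fun hR => ⟨hR.hasFatouProperty X.ideal, hR.isOrderContinuous X.ideal,
    X.kotheDual_isOrderContinuous hR⟩,
  fun ⟨hF, hO, hO'⟩ => X.isReflexive_of_hasFatouProperty hF hO hO'⟩
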